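/- Let $k$ be a field that is complete for a non-Archimedean absolute value (possibly trivial); all Banach spaces over $k$ have norms satisfying the strong triangle inequality, and all maps between Banach spaces called isomorphisms are bounded with bounded inverse. *Enveloping algebra.* Fix root datum: a free $\mathbb Z$-module $\Phi$, $\mathbb Z$-linearly independent simple roots $\alpha_i\in\Phi$ ($i\in I$), a symmetric bilinear form $(\cdot,\cdot):\Phi\times\Phi\to\mathbb Q$ with $(\alpha_i,\alpha_i)$ a positive even integer and $(\alpha_i,\alpha_j)\le 0$ for $i\ne j$, and $\lambda_i\in\operatorname{Hom}(\Phi,\mathbb Z)$ with $\lambda_i(\alpha)=2(\alpha_i,\alpha)/(\alpha_i,\alpha_i)$. Let $U(\mathfrak g)$ be the $k$-algebra generated by $F_i,H_i,E_i$ ($i\in I$) with relations $[H_i,H_j]=0$, $[H_i,E_j]=(\alpha_i,\alpha_j)E_j$, $[H_i,F_j]=-(\alpha_i,\alpha_j)F_j$, $[E_i,F_j]=\delta_{ij}H_i$ and, for $i\neq j$ and $N=1-\lambda_i(\alpha_j)$, the Serre relations $\sum_{m=0}^{N}(-1)^m\binom Nm E_i^{N-m}E_jE_i^m=0=\sum_{m=0}^{N}(-1)^m\binom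 Nm F_i^{N-m}F_jF_i^m$. Let $r,s>0$ with $rs\ge 1$. Let $U(\mathfrak g)^{\rm an}_{r,s}=U^-(\mathfrak g)^{\rm an}_r\hat\otimes\mathscr H_0\hat\otimes U^+(\mathfrak g)^{\rm an}_s$, that is, the Banach algebra obtained by completing $U(\mathfrak g)$ for the seminorm $$\|x\|=\inf\ \max_j |a_j|\,r^{p_j}s^{q_j},$$ the infimum being over all expressions $x=\sum_j a_jw_j$ as finite sums, where $a_j\in k$ and $w_j$ is a product of $p_j$ elements $F_i$, followed by a product of elements $H_i$, followed by a product of $q_j$ elements $E_i$. Let $\mathfrak g_{r,s}$ be the closed Lie subalgebra of $U:=U(\mathfrak g)^{\rm an}_{r,s}$ generated by all $F_i,H_i,E_i$, acting on $U$ by $x\cdot m=xm-mx$. *Bounded cohomology.* Let $C_b^n=C_b^n(\mathfrak g_{r,s},U)$ be the space of bounded alternating $n$-linear maps $\mathfrak g_{r,s}^n\to U$ with its operator norm, and $\delta_n:C_b^n\to C_b^{n+1}$ the Chevalley–Eilenberg differential. Assume that $C_b^\bullet$ is strictly exact at $C_b^2$, that is, $\operatorname{Ker}\delta_2=\operatorname{Im}\delta_1$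 and the bijection $C_b^1/\operatorname{Ker}\delta_1\to\operatorname{Im}\delta_1=\operatorname{Ker}\delta_2$ (quotient norm on the left) is an isomorphism, and that its inverse $\operatorname{Ker}\delta_2\to C_b^1/\operatorname{Ker}\delta_1$ is contracting (of norm at most $1$). *Deformation.* For a Banach algebra $B$ and $\varepsilon>0$ let $B\{\hbar/\varepsilon\}$ be the algebra of power series $\sum_n b_n\hbar^n$ with $\|b_n\|\varepsilon^n\to0$, normed by $\sup_n\|b_n\|\varepsilon^n$. Let $\varepsilon>0$ and let $A$ be a Banach $k\{\hbar/\varepsilon\}$-algebra with contracting multiplication, together with a $k\{\hbar/\varepsilon\}$-linear isomorphism of Banach spaces $\varphi:A\to U\{\hbar/\varepsilon\}$ (bounded with bounded inverse) such that $\varphi(1)=1$. Assume that the multiplication of $A$ is also contracting when it is carried over to $U\{\hbar/\varepsilon\}$, that is, $\|\varphi(\varphi^{-1}(x)\varphi^{-1}(y))\|\le\|x\|\,\|y\|$ for all $x,y\in U\{\hbar/\varepsilon\}$ (this is automatic if $\varphi$ is isometric). Assume finally that the map $\theta:A/\hbar A\to U$ induced by $\varphi$ is an isomorphism of algebras. Then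 for every $\varepsilon'$ with $0<\varepsilon'<\varepsilon$ there is an isomorphism of $k\{\hbar/\varepsilon'\}$-algebras, bounded with bounded inverse, $$\alpha:A_{\varepsilon'}:=A\,\hat\otimes_{k\{\hbar/\varepsilon\}}k\{\hbar/\varepsilon'\}\ \xrightarrow{\ \sim\ }\ U(\mathfrak g)^{\rm an}_{r,s}\{\hbar/\varepsilon'\}$$ inducing the given isomorphism $A_{\varepsilon'}/\hbar A_{\varepsilon'}\cong A/\hbar A\cong U(\mathfrak g)^{\rm an}_{r,s}$; that is, $\alpha(a\otimes1)$ has constant term $\theta(a \bmod \hbar)$ for every $a\in A$. -/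

import Mathlib

open Filter Topology
open scoped TensorProduct

namespace Rigidity

noncomputable section

/-! ### Root data and enveloping algebras -/

/-- Root datum of a (symmetrizable) Kac-Moody Lie algebra with simple roots indexed by `I` and
weight lattice `Φ`.  The root lattice is the span of the (linearly independent) simple roots. -/
structure RootDatum (I : Type*) (Φ : Type*) [AddCommGroup Φ] [Module.Free ℤ Φ] where
  /-- the simple roots `α_i` -/
  root : I → Φ
  root_linearIndependent : LinearIndependent ℤ root
  /-- the symmetric bilinear form on the weight lattice -/
  form : Φ →ₗ[ℤ] Φ →ₗ[ℤ] ℚ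
  form_symm : ∀ x y, form x y = form y x
  form_self : ∀ i, ∃ n : ℕ, 0 < n ∧ form (root i) (root i) = 2 * n
  form_nonpos : ∀ i j, i ≠ j → form (root i) (root j) ≤ 0
  /-- the simple coroots `λ_i` -/
  coroot : I → Φ →ₗ[ℤ] ℤ
  coroot_apply : ∀ i x, (coroot i x : ℚ) = 2 * form (root i) x / form (root i) (root i)

/-- Generators of the enveloping algebra. -/
inductive Gen (I : Type*) : Type _
  | F (i : I) : Gen I
  | H (i : I) : Gen I
  | E (i : I) : Gen I

section Algebraic

variable (k : Type*) [Field k] {I Φ : Type*} [AddCommGroup Φ] [Module.Free ℤ Φ]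

/-- The left hand side `∑ (-1)^m (N choose m) x^(N-m) y x^m` of a Serre relation. -/
def serre {B : Type*} [Ring B] (N : ℕ) (x y : B) : B :=
  ∑ m ∈ Finset.range (N + 1), (((-1) ^ m * (N.choose m : ℤ) : ℤ) : B) * (x ^ (N - m) * y * x ^ m)

/-- The scalar `(α_i, α_j)`; it is always the image of an integer. -/
def RootDatum.pairing (R : RootDatum I Φ) (i j : I) : k := ((R.form (R.root i) (R.root j) : ℚ) : k)

/-- The exponent `1 - λ_i(α_j)` (a natural number for `i ≠ j`) of the Serre relations. -/
def RootDatum.serreExp (R : RootDatum I Φ) (i j : I) : ℕ := (1 - R.coroot i (R.root j)).toNat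

open FreeAlgebra in
/-- The defining relations of `U(𝔤)`. -/
inductive Rel (R : RootDatum I Φ) : FreeAlgebra k (Gen I) → FreeAlgebra k (Gen I) → Prop
  | HH (i j : I) : Rel R (ι k (Gen.H i) * ι k (Gen.H j)) (ι k (Gen.H j) * ι k (Gen.H i))
  | HE (i j : I) : Rel R (ι k (Gen.H i) * ι k (Gen.E j) - ι k (Gen.E j) * ι k (Gen.H i))
      (R.pairing k i j • ι k (Gen.E j))
  | HF (i j : I) : Rel R (ι k (Gen.H i) * ι k (Gen.F j) - ι k (Gen.F j) * ι k (Gen.H i))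
      (-(R.pairing k i j • ι k (Gen.F j)))
  | EF_self (i : I) : Rel R (ι k (Gen.E i) * ι k (Gen.F i) - ι k (Gen.F i) * ι k (Gen.E i))
      (ι k (Gen.H i))
  | EF (i j : I) : i ≠ j →
      Rel R (ι k (Gen.E i) * ι k (Gen.F j) - ι k (Gen.F j) * ι k (Gen.E i)) 0
  | serreE (i j : I) : i ≠ j →
      Rel R (serre (R.serreExp i j) (ι k (Gen.E i)) (ι k (Gen.E j))) 0
  | serreF (i j : I) : i ≠ j →
      Rel R (serre (R.serreExp i j) (ι k (Gen.F i)) (ι k (Gen.F j))) 0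

/-- The enveloping algebra `U(𝔤)` over `k`, by generators and relations. -/
def Env (R : RootDatum I Φ) : Type _ := RingQuot (Rel k R)

instance (R : RootDatum I Φ) : Ring (Env k R) := inferInstanceAs (Ring (RingQuot (Rel k R)))

instance (R : RootDatum I Φ) : Algebra k (Env k R) :=
  inferInstanceAs (Algebra k (RingQuot (Rel k R)))

/-- The projection from the free algebra to `U(𝔤)`. -/
def Env.proj (R : RootDatum I Φ) : FreeAlgebra k (Gen I) →ₐ[k] Env k R :=
  RingQuot.mkAlgHom k (Rel k R)

/-- The image of a generator in `U(𝔤)`. -/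
def Env.gen (R : RootDatum I Φ) (g : Gen I) : Env k R :=
  Env.proj k R (FreeAlgebra.ι k g)

/-- The triangular word `F_{l₁}F_{l₂}⋯ H_{m₁}H_{m₂}⋯ E_{n₁}E_{n₂}⋯` in `U(𝔤)`. -/
def Env.word (R : RootDatum I Φ) (l m n : List I) : Env k R :=
  (l.map fun i => Env.gen k R (Gen.F i)).prod * (m.map fun i => Env.gen k R (Gen.H i)).prod *
    (n.map fun i => Env.gen k R (Gen.E i)).prod

end Algebraic

/-! ### Non-archimedean seminorms generated by a weighted family -/

section Gauge

variable {X : Type*} [AddCommGroup X]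

/-- For an increasing family of sets `G c` of "generators of weight at most `c`", the largest
non-archimedean seminorm for which every element of `G c` has seminorm at most `c`:
`x` is written in all possible ways as a finite sum of generators, and the seminorm is the infimum
of the largest weight that occurs. -/
def gauge (G : ℝ → Set X) (x : X) : ℝ :=
  sInf {c : ℝ | 0 ≤ c ∧ x ∈ AddSubgroup.closure (G c)}

variable {G : ℝ → Set X}

lemma gauge_bddBelow (x : X) : BddBelow {c : ℝ | 0 ≤ c ∧ x ∈ AddSubgroup.closure (G c)} :=
  ⟨0, fun _ h => h.1⟩

lemma gauge_le {x : X} {c : ℝ} (hc : 0 ≤ c) (hx : x ∈ AddSubgroup.closure (G c)) :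
    gauge G x ≤ c :=
  csInf_le (gauge_bddBelow x) ⟨hc, hx⟩

lemma gauge_nonneg (x : X) : 0 ≤ gauge G x :=
  Real.sInf_nonneg fun _ h => h.1

lemma gauge_zero : gauge G (0 : X) = 0 :=
  le_antisymm (gauge_le le_rfl (zero_mem _)) (gauge_nonneg _)

lemma gauge_neg (x : X) : gauge G (-x) = gauge G x := by
  simp [gauge]

lemma gauge_lt (hG : ∀ x, ∃ c, 0 ≤ c ∧ x ∈ AddSubgroup.closure (G c)) {x : X} {d : ℝ}
    (h : gauge G x < d) : ∃ c, 0 ≤ c ∧ c < d ∧ x ∈ AddSubgroup.closure (G c) := by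
  obtain ⟨c, ⟨h0, h1⟩, h2⟩ := exists_lt_of_csInf_lt (hG x) h
  exact ⟨c, h0, h2, h1⟩

lemma gauge_add_le_max (hmono : Monotone G)
    (hG : ∀ x, ∃ c, 0 ≤ c ∧ x ∈ AddSubgroup.closure (G c)) (x y : X) :
    gauge G (x + y) ≤ max (gauge G x) (gauge G y) := by
  refine le_of_forall_gt fun d hd => ?_
  obtain ⟨c, hc0, hc, hx⟩ := gauge_lt hG ((le_max_left _ _).trans_lt hd)
  obtain ⟨c', hc0', hc', hy⟩ := gauge_lt hG ((le_max_right _ _).trans_lt hd)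
  refine (gauge_le (c := max c c') (hc0.trans (le_max_left _ _)) (add_mem ?_ ?_)).trans_lt
    (max_lt hc hc')
  · exact AddSubgroup.closure_mono (hmono (le_max_left _ _)) hx
  · exact AddSubgroup.closure_mono (hmono (le_max_right _ _)) hy

lemma gauge_map_le {f : X →+ X} {a : ℝ} (ha : 0 ≤ a)
    (hf : ∀ c, 0 ≤ c → ∀ x ∈ G c, f x ∈ AddSubgroup.closure (G (a * c)))
    (hG : ∀ x, ∃ c, 0 ≤ c ∧ x ∈ AddSubgroup.closure (G c)) (x : X) :
    gauge G (f x) ≤ a * gauge G x := by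
  have key : ∀ c, 0 ≤ c → x ∈ AddSubgroup.closure (G c) → gauge G (f x) ≤ a * c := by
    intro c hc hx
    refine gauge_le (mul_nonneg ha hc) ?_
    have : AddSubgroup.closure (G c) ≤ (AddSubgroup.closure (G (a * c))).comap f :=
      (AddSubgroup.closure_le _).2 fun y hy => hf c hc y hy
    exact this hx
  refine le_of_forall_pos_le_add fun η hη => ?_
  have h1 : gauge G x < gauge G x + η / (a + 1) := by
    have : 0 < η / (a + 1) := by positivity
    linarith
  obtain ⟨c, hc0, hc, hx⟩ := gauge_lt hG h1
  refine (key c hc0 hx).trans ?_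
  have h2 : a * c ≤ a * (gauge G x + η / (a + 1)) := mul_le_mul_of_nonneg_left hc.le ha
  have h3 : a * (η / (a + 1)) ≤ η := by
    rw [mul_div_assoc', div_le_iff₀ (by positivity)]
    nlinarith
  linarith [mul_add a (gauge G x) (η / (a + 1))]

/-- The gauge on a ring, when the generators are closed under multiplication. -/
def gaugeRingSeminorm {X : Type*} [Ring X] (G : ℝ → Set X) (hmono : Monotone G)
    (hG : ∀ x, ∃ c, 0 ≤ c ∧ x ∈ AddSubgroup.closure (G c))
    (hmul : ∀ c d, 0 ≤ c → 0 ≤ d → ∀ x ∈ G c, ∀ y ∈ G d,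
      x * y ∈ AddSubgroup.closure (G (c * d))) : RingSeminorm X where
  toFun := gauge G
  map_zero' := gauge_zero
  add_le' x y := (gauge_add_le_max hmono hG x y).trans
    (max_le_add_of_nonneg (gauge_nonneg x) (gauge_nonneg y))
  neg' := gauge_neg
  mul_le' x y := by
    have key : ∀ c d, 0 ≤ c → 0 ≤ d → x ∈ AddSubgroup.closure (G c) →
        y ∈ AddSubgroup.closure (G d) → gauge G (x * y) ≤ c * d := by
      intro c d hc hd hx hy
      refine gauge_le (mul_nonneg hc hd) ?_
      refine AddSubgroup.closure_induction (p := fun x _ => x * y ∈ _) ?_ (by simp) ?_ ?_ hx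
      · intro x hx
        refine AddSubgroup.closure_induction (p := fun y _ => x * y ∈ _) ?_ (by simp) ?_ ?_ hy
        · exact fun y hy => hmul c d hc hd x hx y hy
        · intro a b _ _ ha hb
          rw [mul_add]; exact add_mem ha hb
        · intro a _ ha
          rw [mul_neg]; exact neg_mem ha
      · intro a b _ _ ha hb
        rw [add_mul]; exact add_mem ha hb
      · intro a _ ha
        rw [neg_mul]; exact neg_mem ha
    have h1 : ∀ c, gauge G x < c → ∀ d, gauge G y < d → gauge G (x * y) ≤ c * d := by
      intro c hc d hd
      obtain ⟨c', hc0, hcc, hx⟩ := gauge_lt hG hc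
      obtain ⟨d', hd0, hdd, hy⟩ := gauge_lt hG hd
      exact (key c' d' hc0 hd0 hx hy).trans
        (mul_le_mul hcc.le hdd.le hd0 (hc0.trans hcc.le))
    have h2 : Tendsto (fun t : ℝ => (gauge G x + t) * (gauge G y + t)) (𝓝[>] 0)
        (𝓝 (gauge G x * gauge G y)) := by
      have : Continuous fun t : ℝ => (gauge G x + t) * (gauge G y + t) := by fun_prop
      simpa using (this.tendsto 0).mono_left nhdsWithin_le_nhds
    refine ge_of_tendsto h2 ?_
    filter_upwards [self_mem_nhdsWithin] with t ht
    exact h1 _ (lt_add_of_pos_right _ ht) _ (lt_add_of_pos_right _ ht)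

end Gauge

/-! ### The Banach algebra `U(𝔤)^an_{r,s}` -/

/-- Radii `r, s > 0` with `1 ≤ rs`. -/
structure Radii where
  /-- the radius of the negative part -/
  r : ℝ
  /-- the radius of the positive part -/
  s : ℝ
  r_pos : 0 < r
  s_pos : 0 < s
  one_le : 1 ≤ r * s

section Triangular

variable (k : Type*) [NormedField k]
  {I Φ : Type*} [AddCommGroup Φ] [Module.Free ℤ Φ]

/-- Multiples of triangular words of weight at most `c`, where each `F_i` has weight `r`,
each `H_i` has weight `1` and each `E_i` has weight `s`. -/
def triGen (R : RootDatum I Φ) (ρ : Radii) (c : ℝ) : Set (Env k R) :=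
  {x | ∃ (a : k) (l m n : List I),
    ‖a‖ * (ρ.r ^ l.length * ρ.s ^ n.length) ≤ c ∧ x = a • Env.word k R l m n}

variable {k} {R : RootDatum I Φ} {ρ : Radii}

lemma triGen_mono : Monotone (triGen k R ρ) := by
  rintro c d hcd x ⟨a, l, m, n, h, rfl⟩
  exact ⟨a, l, m, n, h.trans hcd, rfl⟩

lemma triGen_smul {c : ℝ} {x : Env k R} (hx : x ∈ AddSubgroup.closure (triGen k R ρ c))
    (b : k) : b • x ∈ AddSubgroup.closure (triGen k R ρ (‖b‖ * c)) := by
  refine AddSubgroup.closure_induction (p := fun x _ => b • x ∈ _) ?_ (by simp) ?_ ?_ hx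
  · rintro _ ⟨a, l, m, n, h, rfl⟩
    refine AddSubgroup.subset_closure ⟨b * a, l, m, n, ?_, by rw [smul_smul]⟩
    rw [norm_mul, mul_assoc]
    exact mul_le_mul_of_nonneg_left h (norm_nonneg b)
  · intro x y _ _ hx hy
    rw [smul_add]; exact add_mem hx hy
  · intro x _ hx
    rw [smul_neg]; exact neg_mem hx

lemma pairing_norm_le [IsUltrametricDist k] (i j : I) : ‖R.pairing k i j‖ ≤ 1 := by
  obtain ⟨n, hn, h⟩ := R.form_self i
  have h1 := R.coroot_apply i (R.root j)
  have h2 : R.form (R.root i) (R.root j) = ((R.coroot i (R.root j) * n : ℤ) : ℚ) := by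
    have : (n : ℚ) ≠ 0 := by exact_mod_cast hn.ne'
    push_cast
    rw [h1, h]
    field_simp
  rw [RootDatum.pairing, h2, Rat.cast_intCast]
  exact IsUltrametricDist.norm_intCast_le_one k _

lemma gen_rel {x y : FreeAlgebra k (Gen I)} (h : Rel k R x y) :
    Env.proj k R x = Env.proj k R y :=
  RingQuot.mkAlgHom_rel k h

lemma gen_HH (i j : I) : Env.gen k R (.H i) * Env.gen k R (.H j) =
    Env.gen k R (.H j) * Env.gen k R (.H i) := by
  have := gen_rel (Rel.HH (k := k) (R := R) i j)
  rw [map_mul, map_mul] at this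
  exact this

lemma gen_HE (i j : I) : Env.gen k R (.H i) * Env.gen k R (.E j) =
    Env.gen k R (.E j) * Env.gen k R (.H i) + R.pairing k i j • Env.gen k R (.E j) := by
  have := gen_rel (Rel.HE (k := k) (R := R) i j)
  rw [map_sub, map_mul, map_mul, map_smul, sub_eq_iff_eq_add'] at this
  exact this

lemma gen_HF (i j : I) : Env.gen k R (.H i) * Env.gen k R (.F j) =
    Env.gen k R (.F j) * Env.gen k R (.H i) + -(R.pairing k i j • Env.gen k R (.F j)) := by
  have := gen_rel (Rel.HF (k := k) (R := R) i j)
  rw [map_sub, map_mul, map_mul, map_neg, map_smul, sub_eq_iff_eq_add'] at this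
  exact this

lemma gen_EF (i j : I) : ∃ b : k, ‖b‖ ≤ 1 ∧ Env.gen k R (.E i) * Env.gen k R (.F j) =
    Env.gen k R (.F j) * Env.gen k R (.E i) + b • Env.gen k R (.H i) := by
  by_cases hij : i = j
  · subst hij
    refine ⟨1, by simp, ?_⟩
    have := gen_rel (Rel.EF_self (k := k) (R := R) i)
    rw [map_sub, map_mul, map_mul, sub_eq_iff_eq_add'] at this
    rw [one_smul]
    exact this
  · refine ⟨0, by simp, ?_⟩
    have := gen_rel (Rel.EF (k := k) (R := R) i j hij)
    rw [map_sub, map_mul, map_mul, map_zero, sub_eq_zero] at this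
    rw [zero_smul, add_zero]
    exact this

/-- The weight of a generator. -/
def Gen.weight (ρ : Radii) : Gen I → ℝ
  | .F _ => ρ.r
  | .H _ => 1
  | .E _ => ρ.s

lemma Gen.weight_pos (g : Gen I) : 0 < g.weight ρ := by
  cases g
  exacts [ρ.r_pos, one_pos, ρ.s_pos]

lemma word_cons_F (i : I) (l m n : List I) :
    Env.word k R (i :: l) m n = Env.gen k R (.F i) * Env.word k R l m n := by
  simp [Env.word, mul_assoc]

lemma word_nil_cons_H (i : I) (m n : List I) :
    Env.word k R [] (i :: m) n = Env.gen k R (.H i) * Env.word k R [] m n := by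
  simp [Env.word, mul_assoc]

lemma word_nil_nil_cons_E (i : I) (n : List I) :
    Env.word k R [] [] (i :: n) = Env.gen k R (.E i) * Env.word k R [] [] n := by
  simp [Env.word]

/-- Left multiplication by `g` maps combinations of words of weight at most `c` to combinations
of weight at most `d`. -/
lemma mul_mem_of_words {g : Env k R} {w : ℝ} {c : ℝ}
    (h : ∀ l m n, g * Env.word k R l m n ∈
      AddSubgroup.closure (triGen k R ρ (w * (ρ.r ^ l.length * ρ.s ^ n.length))))
    (hw : 0 ≤ w) {x : Env k R} (hx : x ∈ AddSubgroup.closure (triGen k R ρ c)) :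
    g * x ∈ AddSubgroup.closure (triGen k R ρ (w * c)) := by
  refine AddSubgroup.closure_induction (p := fun x _ => g * x ∈ _) ?_ (by simp) ?_ ?_ hx
  · rintro _ ⟨a, l, m, n, hc, rfl⟩
    rw [mul_smul_comm]
    refine AddSubgroup.closure_mono (triGen_mono ?_) (triGen_smul (h l m n) a)
    calc ‖a‖ * (w * (ρ.r ^ l.length * ρ.s ^ n.length))
        = w * (‖a‖ * (ρ.r ^ l.length * ρ.s ^ n.length)) := by ring
      _ ≤ w * c := mul_le_mul_of_nonneg_left hc hw
  · intro x y _ _ hx hy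
    rw [mul_add]; exact add_mem hx hy
  · intro x _ hx
    rw [mul_neg]; exact neg_mem hx

lemma word_mem (l m n : List I) : Env.word k R l m n ∈
    AddSubgroup.closure (triGen k R ρ (ρ.r ^ l.length * ρ.s ^ n.length)) :=
  AddSubgroup.subset_closure ⟨1, l, m, n, by simp, by simp⟩

lemma F_mul_word (i : I) (l m n : List I) : Env.gen k R (.F i) * Env.word k R l m n ∈
    AddSubgroup.closure (triGen k R ρ (ρ.r * (ρ.r ^ l.length * ρ.s ^ n.length))) := by
  rw [← word_cons_F]
  convert word_mem (k := k) (R := R) (ρ := ρ) (i :: l) m n using 3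
  simp only [List.length_cons]
  ring

lemma smul_mem_of_le {c d : ℝ} {x : Env k R} (hx : x ∈ AddSubgroup.closure (triGen k R ρ c))
    {b : k} (hb : ‖b‖ ≤ 1) (hc : 0 ≤ c) (hcd : c ≤ d) :
    b • x ∈ AddSubgroup.closure (triGen k R ρ d) := by
  refine AddSubgroup.closure_mono (triGen_mono ?_) (triGen_smul hx b)
  exact (mul_le_of_le_one_left hc hb).trans hcd

lemma weight_nonneg (ρ : Radii) (l n : List I) : 0 ≤ ρ.r ^ l.length * ρ.s ^ n.length :=
  mul_nonneg (pow_nonneg ρ.r_pos.le _) (pow_nonneg ρ.s_pos.le _)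

lemma H_mul_word [IsUltrametricDist k] (i : I) (l m n : List I) :
    Env.gen k R (.H i) * Env.word k R l m n ∈
      AddSubgroup.closure (triGen k R ρ (1 * (ρ.r ^ l.length * ρ.s ^ n.length))) := by
  induction l with
  | nil =>
    rw [← word_nil_cons_H, one_mul]
    exact word_mem [] (i :: m) n
  | cons j l ih =>
    rw [word_cons_F, ← mul_assoc (Env.gen k R _), gen_HF, add_mul, neg_mul, smul_mul_assoc, mul_assoc,
      ← word_cons_F]
    refine add_mem ?_ (neg_mem ?_)
    · convert mul_mem_of_words (F_mul_word (k := k) (R := R) (ρ := ρ) j) ρ.r_pos.le ih using 3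
      simp only [List.length_cons]
      ring
    · refine smul_mem_of_le (word_mem (j :: l) m n) (pairing_norm_le i j) ?_ ?_
      · exact weight_nonneg ρ (j :: l) n
      · rw [one_mul]

lemma E_mul_word [IsUltrametricDist k] (i : I) (l m n : List I) :
    Env.gen k R (.E i) * Env.word k R l m n ∈
      AddSubgroup.closure (triGen k R ρ (ρ.s * (ρ.r ^ l.length * ρ.s ^ n.length))) := by
  induction l with
  | nil =>
    induction m with
    | nil =>
      rw [← word_nil_nil_cons_E]
      convert word_mem (k := k) (R := R) (ρ := ρ) [] [] (i :: n) using 3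
      simp only [List.length_cons, List.length_nil]
      ring
    | cons j m ih =>
      have h : Env.gen k R (.E i) * Env.gen k R (.H j) =
          Env.gen k R (.H j) * Env.gen k R (.E i) + -(R.pairing k j i • Env.gen k R (.E i)) := by
        rw [gen_HE]; abel
      rw [word_nil_cons_H, ← mul_assoc (Env.gen k R _), h, add_mul, neg_mul, smul_mul_assoc, mul_assoc]
      refine add_mem ?_ (neg_mem ?_)
      · convert mul_mem_of_words (H_mul_word (k := k) (R := R) (ρ := ρ) j) zero_le_one ih using 3
        simp only [List.length_nil]
        ring
      · exact smul_mem_of_le ih (pairing_norm_le j i)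
          (mul_nonneg ρ.s_pos.le (weight_nonneg ρ [] n)) le_rfl
  | cons j l ih =>
    obtain ⟨b, hb, h⟩ := gen_EF (k := k) (R := R) i j
    rw [word_cons_F, ← mul_assoc (Env.gen k R _), h, add_mul, smul_mul_assoc, mul_assoc]
    refine add_mem ?_ ?_
    · convert mul_mem_of_words (F_mul_word (k := k) (R := R) (ρ := ρ) j) ρ.r_pos.le ih using 3
      simp only [List.length_cons]
      ring
    · refine smul_mem_of_le (H_mul_word i l m n) hb ?_ ?_
      · rw [one_mul]
        exact weight_nonneg ρ l n
      · rw [List.length_cons]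
        have := mul_le_mul_of_nonneg_right ρ.one_le (weight_nonneg ρ l n)
        calc 1 * (ρ.r ^ l.length * ρ.s ^ n.length)
            ≤ ρ.r * ρ.s * (ρ.r ^ l.length * ρ.s ^ n.length) := this
          _ = ρ.s * (ρ.r ^ (l.length + 1) * ρ.s ^ n.length) := by ring

lemma gen_mul_mem [IsUltrametricDist k] (g : Gen I) {c : ℝ} {x : Env k R}
    (hx : x ∈ AddSubgroup.closure (triGen k R ρ c)) :
    Env.gen k R g * x ∈ AddSubgroup.closure (triGen k R ρ (g.weight ρ * c)) := by
  refine mul_mem_of_words (fun l m n => ?_) g.weight_pos.le hx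
  cases g
  exacts [F_mul_word _ l m n, H_mul_word _ l m n, E_mul_word _ l m n]

lemma list_mul_mem [IsUltrametricDist k] (f : I → Gen I) {w : ℝ}
    (hw : ∀ i, (f i).weight ρ = w) (l : List I) {c : ℝ} {x : Env k R}
    (hx : x ∈ AddSubgroup.closure (triGen k R ρ c)) :
    (l.map fun i => Env.gen k R (f i)).prod * x ∈
      AddSubgroup.closure (triGen k R ρ (w ^ l.length * c)) := by
  induction l with
  | nil => simpa using hx
  | cons i l ih =>
    rw [List.map_cons, List.prod_cons, mul_assoc]
    convert gen_mul_mem (f i) ih using 3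
    rw [hw, List.length_cons]
    ring

lemma triGen_mul [IsUltrametricDist k] (c d : ℝ) (_ : 0 ≤ c) (hd : 0 ≤ d) (x : Env k R)
    (hx : x ∈ triGen k R ρ c) (y : Env k R) (hy : y ∈ triGen k R ρ d) :
    x * y ∈ AddSubgroup.closure (triGen k R ρ (c * d)) := by
  obtain ⟨a, l, m, n, h, rfl⟩ := hx
  have h1 := list_mul_mem (k := k) (R := R) (ρ := ρ) (.E : I → Gen I) (fun _ => rfl) n
    (AddSubgroup.subset_closure hy)
  have h2 := list_mul_mem (.H : I → Gen I) (fun _ => rfl) m h1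
  have h3 := triGen_smul (list_mul_mem (.F : I → Gen I) (fun _ => rfl) l h2) a
  rw [smul_mul_assoc, Env.word, mul_assoc, mul_assoc]
  refine AddSubgroup.closure_mono (triGen_mono ?_) h3
  calc ‖a‖ * (ρ.r ^ l.length * (1 ^ m.length * (ρ.s ^ n.length * d)))
      = ‖a‖ * (ρ.r ^ l.length * ρ.s ^ n.length) * d := by rw [one_pow]; ring
    _ ≤ c * d := mul_le_mul_of_nonneg_right h hd

lemma triGen_total [IsUltrametricDist k] (x : Env k R) :
    ∃ c, 0 ≤ c ∧ x ∈ AddSubgroup.closure (triGen k R ρ c) := by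
  obtain ⟨y, rfl⟩ : ∃ y, Env.proj k R y = x := RingQuot.mkAlgHom_surjective k (Rel k R) x
  have h1 : (1 : Env k R) ∈ AddSubgroup.closure (triGen k R ρ 1) := by
    convert word_mem (k := k) (R := R) (ρ := ρ) [] [] [] using 3 <;> simp [Env.word]
  suffices H : ∀ z : Env k R, (∃ c, 0 ≤ c ∧ z ∈ AddSubgroup.closure (triGen k R ρ c)) →
      ∃ c, 0 ≤ c ∧ Env.proj k R y * z ∈
        AddSubgroup.closure (triGen k R ρ c) by
    have := H 1 ⟨1, zero_le_one, h1⟩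
    rwa [mul_one] at this
  induction y using FreeAlgebra.induction with
  | grade0 a =>
    rintro z ⟨c, hc, hz⟩
    rw [AlgHom.commutes]
    refine ⟨‖a‖ * c, by positivity, ?_⟩
    have := triGen_smul hz a
    rwa [Algebra.smul_def] at this
  | grade1 g =>
    rintro z ⟨c, hc, hz⟩
    exact ⟨_, mul_nonneg g.weight_pos.le hc, gen_mul_mem g hz⟩
  | mul a b ha hb =>
    intro z hz
    have h := ha _ (hb z hz)
    rw [map_mul]
    rwa [← mul_assoc] at h
  | add a b ha hb =>
    intro z hz
    obtain ⟨c, hc, h⟩ := ha z hz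
    obtain ⟨d, hd, h'⟩ := hb z hz
    refine ⟨max c d, hc.trans (le_max_left _ _), ?_⟩
    rw [map_add, add_mul]
    refine add_mem ?_ ?_
    · exact AddSubgroup.closure_mono (triGen_mono (le_max_left _ _)) h
    · exact AddSubgroup.closure_mono (triGen_mono (le_max_right _ _)) h'

end Triangular

section EnvAn

variable (k : Type*) [NormedField k] [IsUltrametricDist k]
  {I Φ : Type*} [AddCommGroup Φ] [Module.Free ℤ Φ]

/-- `U(𝔤)`, to be equipped with the seminorm of radii `ρ = (r, s)`. -/
@[nolint unusedArguments]
def EnvTri (R : RootDatum I Φ) (_ρ : Radii) : Type _ := Env k R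

variable (R : RootDatum I Φ) (ρ : Radii)

instance : Ring (EnvTri k R ρ) := inferInstanceAs (Ring (Env k R))

instance : Algebra k (EnvTri k R ρ) := inferInstanceAs (Algebra k (Env k R))

/-- `U(𝔤) = U⁻(𝔤) ⊗ U⁰(𝔤) ⊗ U⁺(𝔤)` carries the tensor product of the quotient seminorms on the
three factors: the infimum, over all ways of writing an element as a linear combination of
triangular words, of the largest weight `|a| r^(number of F) s^(number of E)` that occurs. -/
instance : SeminormedRing (EnvTri k R ρ) :=
  (gaugeRingSeminorm (X := EnvTri k R ρ) (triGen k R ρ) triGen_mono triGen_total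
    triGen_mul).toSeminormedRing

lemma EnvTri.norm_def (x : EnvTri k R ρ) : ‖x‖ = gauge (triGen k R ρ) x := rfl

instance : NormedSpace k (EnvTri k R ρ) where
  norm_smul_le a x := by
    refine gauge_map_le (X := Env k R) (G := triGen k R ρ)
      (f := DistribSMul.toAddMonoidHom (Env k R) a) (norm_nonneg a) ?_ triGen_total x
    intro c _ y hy
    exact triGen_smul (AddSubgroup.subset_closure hy) a

instance : IsUltrametricDist (EnvTri k R ρ) :=
  IsUltrametricDist.isUltrametricDist_of_forall_norm_add_le_max_norm
    fun x y => gauge_add_le_max (X := Env k R) triGen_mono triGen_total x y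

/-- The Banach algebra `U(𝔤)^an_{r,s} = U⁻(𝔤)^an_r ⊗̂ 𝓗₀ ⊗̂ U⁺(𝔤)^an_s`: the (separated)
completion of `U(𝔤) = U⁻(𝔤) ⊗ U⁰(𝔤) ⊗ U⁺(𝔤)`. -/
def EnvAn : Type _ := UniformSpace.Completion (EnvTri k R ρ)

instance : NormedRing (EnvAn k R ρ) :=
  inferInstanceAs (NormedRing (UniformSpace.Completion (EnvTri k R ρ)))

instance : CompleteSpace (EnvAn k R ρ) :=
  inferInstanceAs (CompleteSpace (UniformSpace.Completion (EnvTri k R ρ)))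

instance : NormedAlgebra k (EnvAn k R ρ) where
  __ := (inferInstanceAs (Algebra k (UniformSpace.Completion (EnvTri k R ρ))) :
    Algebra k (EnvAn k R ρ))
  norm_smul_le a x := norm_smul_le (β := UniformSpace.Completion (EnvTri k R ρ)) a x

instance : IsUltrametricDist (EnvAn k R ρ) :=
  IsUltrametricDist.isUltrametricDist_of_forall_norm_add_le_max_norm fun x y => by
    induction x, y using UniformSpace.Completion.induction_on₂ with
    | hp =>
      exact isClosed_le (f := fun x : UniformSpace.Completion (EnvTri k R ρ) ×
        UniformSpace.Completion (EnvTri k R ρ) => ‖x.1 + x.2‖) (by fun_prop) (by fun_prop)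
    | ih x y =>
      have := IsUltrametricDist.norm_add_le_max x y
      rw [← UniformSpace.Completion.norm_coe, ← UniformSpace.Completion.norm_coe x,
        ← UniformSpace.Completion.norm_coe y, UniformSpace.Completion.coe_add] at this
      exact this

/-- The commutator bracket `[x, y] = xy - yx`. -/
instance : LieRing (EnvAn k R ρ) := LieRing.ofAssociativeRing

/-- The elements `F_i`, `H_i`, `E_i` of `U(𝔤)^an_{r,s}`. -/
def EnvAn.gen (g : Gen I) : EnvAn k R ρ :=
  UniformSpace.Completion.coe' (α := EnvTri k R ρ) (Env.gen k R g)

/-- `𝔤_{r,s}`: the closed Lie subalgebra of `U(𝔤)^an_{r,s}` generated by all `F_i`, `H_i`, `E_i`. -/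
def lieAn : LieSubalgebra k (EnvAn k R ρ) :=
  sInf {L | IsClosed (L : Set (EnvAn k R ρ)) ∧ ∀ g, EnvAn.gen k R ρ g ∈ L}

end EnvAn

/-! ### Bounded Lie algebra cohomology around degree two

The cochains and differentials are those of `LieModule.Cohomology`:
`(d₁₂ f)(x, y) = x f(y) - y f(x) - f([x, y])`, and `d₂₃` is the next Chevalley-Eilenberg
differential, on alternating bilinear maps. -/

section Cohomology

open LieModule.Cohomology

variable (k L M : Type*) [Field k] [LieRing L] [LieAlgebra k L] [Norm L]
  [NormedAddCommGroup M] [Module k M] [LieRingModule L M] [LieModule k L M]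

variable {k L M} in
/-- Boundedness of a 1-cochain. -/
def IsBounded₁ (f : oneCochain k L M) : Prop := ∃ C : ℝ, ∀ x, ‖f x‖ ≤ C * ‖x‖

variable {k L M} in
/-- Boundedness of a 2-cochain. -/
def IsBounded₂ (f : twoCochain k L M) : Prop := ∃ C : ℝ, ∀ x y, ‖f x y‖ ≤ C * ‖x‖ * ‖y‖

variable {k L M} in
/-- The norm of a bounded 1-cochain: the least bound. -/
def norm₁ (f : oneCochain k L M) : ℝ := sInf {C | 0 ≤ C ∧ ∀ x, ‖f x‖ ≤ C * ‖x‖}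

variable {k L M} in
/-- The norm of a bounded 2-cochain: the least bound. -/
def norm₂ (f : twoCochain k L M) : ℝ := sInf {C | 0 ≤ C ∧ ∀ x y, ‖f x y‖ ≤ C * ‖x‖ * ‖y‖}

variable {k L M} in
/-- The quotient norm of the class of a bounded 1-cochain `f` in `C_b¹ / Ker δ₁`. -/
def quotNorm₁ (f : oneCochain k L M) : ℝ :=
  sInf {c | ∃ z : oneCochain k L M, IsBounded₁ z ∧ d₁₂ k L M z = 0 ∧ c = norm₁ (f + z)}

/-- `H_b²(L, M) = 0`: every bounded 2-cocycle is the coboundary of a bounded 1-cochain. -/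
def BoundedH2Vanishes : Prop :=
  ∀ f : twoCochain k L M, IsBounded₂ f → d₂₃ k L M f = 0 →
    ∃ a : oneCochain k L M, IsBounded₁ a ∧ d₁₂ k L M a = f

/-- The complex of bounded cochains is strictly exact in degree two: `H_b²(L, M) = 0`, and the
bijection `C_b¹ / Ker δ₁ → Im δ₁ = Ker δ₂` is bounded with bounded inverse. -/
def StrictlyExactAtTwo : Prop :=
  BoundedH2Vanishes k L M ∧
    (∃ C : ℝ, ∀ a : oneCochain k L M, IsBounded₁ a → norm₂ (d₁₂ k L M a) ≤ C * quotNorm₁ a) ∧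
    ∃ C : ℝ, ∀ a : oneCochain k L M, IsBounded₁ a → quotNorm₁ a ≤ C * norm₂ (d₁₂ k L M a)

/-- The inverse `Ker δ₂ = Im δ₁ → C_b¹ / Ker δ₁` is contracting. -/
def ContractingInverseAtTwo : Prop :=
  ∀ a : oneCochain k L M, IsBounded₁ a → quotNorm₁ a ≤ norm₂ (d₁₂ k L M a)

end Cohomology

/-! ### Convergent power series `B{ħ/ε}` -/

section Series

/-- `B{ħ/ε}`: power series `∑ bₙ ħⁿ` over `B` with `‖bₙ‖ εⁿ → 0`. -/
def ConvSeries (B : Type*) [NormedRing B] [IsUltrametricDist B] (ε : ℝ) : Type _ :=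
  PowerSeries.IsRestricted.subring (R := B) ε

namespace ConvSeries

variable {B : Type*} [NormedRing B] [IsUltrametricDist B] {ε : ℝ}

instance : Ring (ConvSeries B ε) :=
  inferInstanceAs (Ring (PowerSeries.IsRestricted.subring (R := B) ε))

/-- The underlying power series. -/
def toPowerSeries : ConvSeries B ε →+* PowerSeries B :=
  (PowerSeries.IsRestricted.subring (R := B) ε).subtype

/-- The coefficient of `ħⁿ`. -/
def coeff (n : ℕ) (f : ConvSeries B ε) : B := PowerSeries.coeff n (toPowerSeries f)

lemma toPowerSeries_injective : Function.Injective (toPowerSeries (B := B) (ε := ε)) :=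
  Subtype.val_injective

lemma tendsto (f : ConvSeries B ε) : Tendsto (fun n => ‖coeff n f‖ * ε ^ n) atTop (𝓝 0) :=
  (PowerSeries.isRestricted_iff' ε _).1 f.2

/-- A power series with `‖bₙ‖ εⁿ → 0`, as an element of `B{ħ/ε}`. -/
def mk (f : PowerSeries B)
    (hf : Tendsto (fun n => ‖PowerSeries.coeff n f‖ * ε ^ n) atTop (𝓝 0)) : ConvSeries B ε :=
  ⟨f, (PowerSeries.isRestricted_iff' ε f).2 hf⟩

lemma toPowerSeries_mk (f : PowerSeries B)
    (hf : Tendsto (fun n => ‖PowerSeries.coeff n f‖ * ε ^ n) atTop (𝓝 0)) :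
    toPowerSeries (mk f hf) = f := rfl

/-- Reduction modulo `ħ`. -/
def constCoeff : ConvSeries B ε →+* B :=
  (PowerSeries.constantCoeff (R := B)).comp toPowerSeries

lemma hasGaussNorm (f : ConvSeries B ε) :
    PowerSeries.HasGaussNorm (fun b : B => ‖b‖) ε (toPowerSeries f) :=
  f.tendsto.bddAbove_range

/-- `B{ħ/ε}` is normed by `‖∑ bₙ ħⁿ‖ = sup ‖bₙ‖ εⁿ`. -/
instance : Norm (ConvSeries B ε) := ⟨fun f => ⨆ n, ‖coeff n f‖ * ε ^ n⟩

lemma norm_def (f : ConvSeries B ε) : ‖f‖ = ⨆ n, ‖coeff n f‖ * ε ^ n := rfl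

lemma norm_eq_gaussNorm (f : ConvSeries B ε) :
    ‖f‖ = PowerSeries.gaussNorm (fun b : B => ‖b‖) ε (toPowerSeries f) :=
  (PowerSeries.gaussNorm_eq _ _ _).symm

lemma norm_add_le_max [hε : Fact (0 < ε)] (f g : ConvSeries B ε) : ‖f + g‖ ≤ max ‖f‖ ‖g‖ := by
  simp only [norm_eq_gaussNorm, map_add]
  exact PowerSeries.gaussNorm_add_le_max _ _ _ _ hε.out.le (fun a => norm_nonneg a)
    IsUltrametricDist.norm_add_le_max f.hasGaussNorm g.hasGaussNorm

lemma le_norm (f : ConvSeries B ε) (n : ℕ) : ‖coeff n f‖ * ε ^ n ≤ ‖f‖ :=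
  le_ciSup f.hasGaussNorm n

lemma norm_nonneg' [hε : Fact (0 < ε)] (f : ConvSeries B ε) : 0 ≤ ‖f‖ :=
  (mul_nonneg (norm_nonneg _) (pow_nonneg hε.out.le _)).trans (le_norm f 0)

lemma coeff_mul (n : ℕ) (f g : ConvSeries B ε) : coeff n (f * g) =
    ∑ p ∈ Finset.HasAntidiagonal.antidiagonal n, coeff p.1 f * coeff p.2 g := by
  simp [coeff, PowerSeries.coeff_mul]

lemma norm_mul_le' [hε : Fact (0 < ε)] (f g : ConvSeries B ε) : ‖f * g‖ ≤ ‖f‖ * ‖g‖ := by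
  refine ciSup_le fun n => ?_
  rw [coeff_mul]
  have hpos : (0 : ℝ) < ε ^ n := pow_pos hε.out n
  rw [← le_div_iff₀ hpos]
  refine IsUltrametricDist.norm_sum_le_of_forall_le_of_nonneg
    (div_nonneg (mul_nonneg (norm_nonneg' f) (norm_nonneg' g)) hpos.le) fun p hp => ?_
  rw [le_div_iff₀ hpos]
  have hp' : p.1 + p.2 = n := Finset.HasAntidiagonal.mem_antidiagonal.1 hp
  calc ‖coeff p.1 f * coeff p.2 g‖ * ε ^ n
      ≤ ‖coeff p.1 f‖ * ‖coeff p.2 g‖ * ε ^ n :=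
        mul_le_mul_of_nonneg_right (norm_mul_le _ _) hpos.le
    _ = (‖coeff p.1 f‖ * ε ^ p.1) * (‖coeff p.2 g‖ * ε ^ p.2) := by
        rw [← hp', pow_add]; ring
    _ ≤ ‖f‖ * ‖g‖ := mul_le_mul (le_norm f _) (le_norm g _)
        (mul_nonneg (norm_nonneg _) (pow_nonneg hε.out.le _)) (norm_nonneg' f)

/-- The norm of `B{ħ/ε}` as a ring norm. -/
def ringNorm [hε : Fact (0 < ε)] : RingNorm (ConvSeries B ε) where
  toFun f := ‖f‖
  map_zero' := by simp [norm_def, coeff]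
  add_le' f g := (norm_add_le_max f g).trans
    (max_le_add_of_nonneg (norm_nonneg' f) (norm_nonneg' g))
  neg' f := by simp [norm_def, coeff]
  mul_le' := norm_mul_le'
  eq_zero_of_map_eq_zero' f hf := by
    refine toPowerSeries_injective (PowerSeries.ext fun n => ?_)
    have h1 := le_norm f n
    change ‖f‖ = 0 at hf
    rw [hf] at h1
    have h2 : ‖coeff n f‖ ≤ 0 := by
      by_contra h
      exact absurd h1 (not_le.2 (mul_pos (not_le.1 h) (pow_pos hε.out n)))
    simpa [coeff] using h2

instance [Fact (0 < ε)] : NormedRing (ConvSeries B ε) :=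
  { ringNorm.toNormedRing with norm := fun f => ‖f‖ }

instance [Fact (0 < ε)] : IsUltrametricDist (ConvSeries B ε) :=
  IsUltrametricDist.isUltrametricDist_of_forall_norm_add_le_max_norm norm_add_le_max

variable (k : Type*) [NormedField k] [IsUltrametricDist k]

instance [Fact (0 < ε)] : NormedCommRing (ConvSeries k ε) where
  mul_comm f g := toPowerSeries_injective (by rw [map_mul, map_mul, mul_comm])

/-- The constants `k → k{ħ/ε}`. -/
def C : k →+* ConvSeries k ε where
  toFun a := ⟨PowerSeries.C a, PowerSeries.isRestricted_C ε a⟩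
  map_one' := toPowerSeries_injective (map_one _)
  map_mul' a b := toPowerSeries_injective (map_mul (PowerSeries.C (R := k)) a b)
  map_zero' := toPowerSeries_injective (map_zero (PowerSeries.C (R := k)))
  map_add' a b := toPowerSeries_injective (map_add (PowerSeries.C (R := k)) a b)

instance [Fact (0 < ε)] : Algebra k (ConvSeries k ε) := (C k).toAlgebra

/-- The element `ħ` of `k{ħ/ε}`. -/
def hbar (ε : ℝ) : ConvSeries k ε :=
  ⟨PowerSeries.X, PowerSeries.isRestricted_monomial ε 1 1⟩

/-- The restriction map `k{ħ/ε} → k{ħ/ε'}` for `ε' < ε`. -/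
def restrict {ε ε' : ℝ} [h' : Fact (0 < ε')] (h : ε' < ε) :
    ConvSeries k ε →+* ConvSeries k ε' where
  toFun f := mk (toPowerSeries f) (squeeze_zero
    (fun n => mul_nonneg (norm_nonneg _) (pow_nonneg h'.out.le n))
    (fun n => mul_le_mul_of_nonneg_left (pow_le_pow_left₀ h'.out.le h.le n) (norm_nonneg _))
    f.tendsto)
  map_one' := toPowerSeries_injective (by rw [toPowerSeries_mk, map_one, map_one])
  map_mul' a b := toPowerSeries_injective (by
    rw [toPowerSeries_mk, map_mul, map_mul, toPowerSeries_mk, toPowerSeries_mk])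
  map_zero' := toPowerSeries_injective (by rw [toPowerSeries_mk, map_zero, map_zero])
  map_add' a b := toPowerSeries_injective (by
    rw [toPowerSeries_mk, map_add, map_add, toPowerSeries_mk, toPowerSeries_mk])

instance {ε ε' : ℝ} [Fact (0 < ε)] [Fact (0 < ε')] [h : Fact (ε' < ε)] :
    Algebra (ConvSeries k ε) (ConvSeries k ε') :=
  (restrict k h.out).toAlgebra

/-- For a Banach algebra `B` over `k`, the map `k{ħ/ε} → B{ħ/ε}`, coefficient by coefficient. -/
def mapAlg (B : Type*) [NormedRing B] [IsUltrametricDist B] [NormedAlgebra k B] (ε : ℝ)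
    [h : Fact (0 < ε)] : ConvSeries k ε →+* ConvSeries B ε where
  toFun f := mk (PowerSeries.map (algebraMap k B) (toPowerSeries f)) (by
    refine squeeze_zero (fun n => mul_nonneg (norm_nonneg _) (pow_nonneg h.out.le n))
      (g := fun n => ‖coeff n f‖ * ε ^ n * ‖(1 : B)‖) (fun n => ?_) ?_
    · rw [PowerSeries.coeff_map, norm_algebraMap, coeff]
      exact le_of_eq (by ring)
    · simpa using f.tendsto.mul_const ‖(1 : B)‖)
  map_one' := toPowerSeries_injective (by rw [toPowerSeries_mk, map_one, map_one, map_one])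
  map_mul' a b := toPowerSeries_injective (by
    rw [toPowerSeries_mk, map_mul, map_mul, map_mul, toPowerSeries_mk, toPowerSeries_mk])
  map_zero' := toPowerSeries_injective (by rw [toPowerSeries_mk, map_zero, map_zero, map_zero])
  map_add' a b := toPowerSeries_injective (by
    rw [toPowerSeries_mk, map_add, map_add, map_add, toPowerSeries_mk, toPowerSeries_mk])

lemma mapAlg_commutes (B : Type*) [NormedRing B] [IsUltrametricDist B] [NormedAlgebra k B] (ε : ℝ)
    [Fact (0 < ε)] (f : ConvSeries k ε) (g : ConvSeries B ε) :
    mapAlg k B ε f * g = g * mapAlg k B ε f := by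
  refine toPowerSeries_injective (PowerSeries.ext fun n => ?_)
  rw [map_mul toPowerSeries, map_mul toPowerSeries, PowerSeries.coeff_mul, PowerSeries.coeff_mul,
    ← Finset.Nat.sum_antidiagonal_swap]
  refine Finset.sum_congr rfl fun p _ => ?_
  change PowerSeries.coeff _ (PowerSeries.map (algebraMap k B) (toPowerSeries f)) * _ =
    _ * PowerSeries.coeff _ (PowerSeries.map (algebraMap k B) (toPowerSeries f))
  rw [PowerSeries.coeff_map]
  exact Algebra.commutes _ _

end ConvSeries

variable (k : Type*) [NormedField k] [IsUltrametricDist k]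
  {I Φ : Type*} [AddCommGroup Φ] [Module.Free ℤ Φ] (R : RootDatum I Φ) (ρ : Radii)

/-- `U(𝔤)^an_{r,s}{ħ/ε}` as a `k{ħ/ε}`-algebra: the trivial deformation. -/
instance (ε : ℝ) [Fact (0 < ε)] : Algebra (ConvSeries k ε) (ConvSeries (EnvAn k R ρ) ε) :=
  (ConvSeries.mapAlg k (EnvAn k R ρ) ε).toAlgebra' (ConvSeries.mapAlg_commutes k _ ε)

end Series

/-! ### Reduction modulo `ħ` and completed base change -/

section BaseChange

variable (k : Type*) [NormedField k] [IsUltrametricDist k]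

/-- The two-sided ideal `ħA` of a `k{ħ/ε}`-algebra `A`. -/
def hbarIdeal (ε : ℝ) [Fact (0 < ε)] (A : Type*) [Ring A] [Algebra (ConvSeries k ε) A] :
    Ideal A :=
  Ideal.span {algebraMap (ConvSeries k ε) A (ConvSeries.hbar k ε)}

instance (ε : ℝ) [Fact (0 < ε)] (A : Type*) [Ring A] [Algebra (ConvSeries k ε) A] :
    (hbarIdeal k ε A).IsTwoSided where
  mul_mem_of_left b ha := by
    obtain ⟨c, rfl⟩ := Ideal.mem_span_singleton'.1 ha
    rw [mul_assoc, Algebra.commutes, ← mul_assoc]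
    exact Ideal.mul_mem_left _ _ (Ideal.subset_span rfl)

variable (ε ε' : ℝ) [Fact (0 < ε)] [Fact (0 < ε')] [Fact (ε' < ε)]
  (A : Type*) [NormedRing A] [Algebra (ConvSeries k ε) A]

/-- The algebraic base change `k{ħ/ε'} ⊗_{k{ħ/ε}} A`, to be equipped with its tensor seminorm. -/
def AlgBaseChange : Type _ := ConvSeries k ε' ⊗[ConvSeries k ε] A

instance : Ring (AlgBaseChange k ε ε' A) :=
  inferInstanceAs (Ring (ConvSeries k ε' ⊗[ConvSeries k ε] A))

instance : Algebra (ConvSeries k ε') (AlgBaseChange k ε ε' A) :=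
  inferInstanceAs (Algebra (ConvSeries k ε') (ConvSeries k ε' ⊗[ConvSeries k ε] A))

/-- Pure tensors `b ⊗ a` with `‖b‖ ‖a‖ ≤ c`. -/
def tensorGen (c : ℝ) : Set (AlgBaseChange k ε ε' A) :=
  {x | ∃ (b : ConvSeries k ε') (a : A), ‖b‖ * ‖a‖ ≤ c ∧ x = b ⊗ₜ[ConvSeries k ε] a}

variable {k ε ε' A}

lemma tensorGen_mono : Monotone (tensorGen k ε ε' A) := by
  rintro c d hcd x ⟨b, a, h, rfl⟩
  exact ⟨b, a, h.trans hcd, rfl⟩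

lemma tensorGen_total (x : AlgBaseChange k ε ε' A) :
    ∃ c, 0 ≤ c ∧ x ∈ AddSubgroup.closure (tensorGen k ε ε' A c) := by
  induction x using TensorProduct.induction_on with
  | zero => exact ⟨0, le_rfl, zero_mem _⟩
  | tmul b a => exact ⟨‖b‖ * ‖a‖, by positivity, AddSubgroup.subset_closure ⟨b, a, le_rfl, rfl⟩⟩
  | add x y hx hy =>
    obtain ⟨c, hc, hx⟩ := hx
    obtain ⟨d, hd, hy⟩ := hy
    refine ⟨max c d, hc.trans (le_max_left _ _), add_mem ?_ ?_⟩
    · exact AddSubgroup.closure_mono (tensorGen_mono (le_max_left _ _)) hx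
    · exact AddSubgroup.closure_mono (tensorGen_mono (le_max_right _ _)) hy

lemma tensorGen_mul (c d : ℝ) (hc : 0 ≤ c) (_ : 0 ≤ d) (x : AlgBaseChange k ε ε' A)
    (hx : x ∈ tensorGen k ε ε' A c) (y : AlgBaseChange k ε ε' A)
    (hy : y ∈ tensorGen k ε ε' A d) :
    x * y ∈ AddSubgroup.closure (tensorGen k ε ε' A (c * d)) := by
  obtain ⟨b, a, h, rfl⟩ := hx
  obtain ⟨b', a', h', rfl⟩ := hy
  refine AddSubgroup.subset_closure ⟨b * b', a * a', ?_, Algebra.TensorProduct.tmul_mul_tmul ..⟩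
  calc ‖b * b'‖ * ‖a * a'‖ ≤ (‖b‖ * ‖b'‖) * (‖a‖ * ‖a'‖) := by
        gcongr <;> exact norm_mul_le _ _
    _ = (‖b‖ * ‖a‖) * (‖b'‖ * ‖a'‖) := by ring
    _ ≤ c * d := by gcongr

/-- The projective (non-archimedean) tensor seminorm: the infimum over all representations
`∑ bⱼ ⊗ aⱼ` of `max ‖bⱼ‖ ‖aⱼ‖`. -/
instance : SeminormedRing (AlgBaseChange k ε ε' A) :=
  (gaugeRingSeminorm (tensorGen k ε ε' A) tensorGen_mono tensorGen_total
    tensorGen_mul).toSeminormedRing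

instance : IsBoundedSMul (ConvSeries k ε') (AlgBaseChange k ε ε' A) :=
  IsBoundedSMul.of_norm_smul_le fun b x => by
    refine gauge_map_le (X := AlgBaseChange k ε ε' A) (G := tensorGen k ε ε' A)
      (f := DistribSMul.toAddMonoidHom (AlgBaseChange k ε ε' A) b) (norm_nonneg b) ?_
      tensorGen_total x
    rintro c _ _ ⟨b', a, h, rfl⟩
    refine AddSubgroup.subset_closure ⟨b * b', a, ?_, ?_⟩
    · calc ‖b * b'‖ * ‖a‖ ≤ ‖b‖ * ‖b'‖ * ‖a‖ := by gcongr; exact norm_mul_le _ _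
        _ = ‖b‖ * (‖b'‖ * ‖a‖) := by ring
        _ ≤ ‖b‖ * c := by gcongr
    · exact TensorProduct.smul_tmul' b b' a

variable (k ε ε' A)

/-- The completed base change `A_{ε'} = A ⊗̂_{k{ħ/ε}} k{ħ/ε'}`, a Banach algebra over `k{ħ/ε'}`. -/
def BaseChange : Type _ := UniformSpace.Completion (AlgBaseChange k ε ε' A)

instance : NormedRing (BaseChange k ε ε' A) :=
  inferInstanceAs (NormedRing (UniformSpace.Completion (AlgBaseChange k ε ε' A)))

instance : CompleteSpace (BaseChange k ε ε' A) :=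
  inferInstanceAs (CompleteSpace (UniformSpace.Completion (AlgBaseChange k ε ε' A)))

instance : Algebra (ConvSeries k ε') (BaseChange k ε ε' A) :=
  inferInstanceAs (Algebra (ConvSeries k ε')
    (UniformSpace.Completion (AlgBaseChange k ε ε' A)))

/-- The canonical map `A → A_{ε'}`, `a ↦ 1 ⊗ a`. -/
def BaseChange.of (a : A) : BaseChange k ε ε' A :=
  UniformSpace.Completion.coe' (α := AlgBaseChange k ε ε' A)
    ((1 : ConvSeries k ε') ⊗ₜ[ConvSeries k ε] a)

end BaseChange

/-- A map between normed spaces is bounded if `‖f x‖ ≤ C ‖x‖` for some constant `C`. -/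
def IsBoundedMap {X Y : Type*} [Norm X] [Norm Y] (f : X → Y) : Prop :=
  ∃ C : ℝ, ∀ x, ‖f x‖ ≤ C * ‖x‖

end

end Rigidity

/-! Transport the product of the base change to `U{ħ/ε'}`. The result is a product whose
`ħⁿ`-coefficient on constants `u`, `v` has norm at most `‖u‖ ‖v‖ ε⁻ⁿ`. It therefore still converges
at the larger radius `ε`, and the gap between `ε'` and `ε` pays for every loss in the proof. This
situation is recorded in `Deformation`, with inner radius `ε` and outer radius `η`; the final
theorem uses it with `ε'` and `ε` in these roles.

The inclusion of `𝔤_{r,s}` in `U` lifts to a Lie homomorphism `J` into the deformed algebra `B`, one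
power of `ħ` at a time. If a lift is a homomorphism modulo `ħⁿ`, the `ħⁿ`-coefficient of its defect
is a bounded 2-cocycle, by the Jacobi identity and because leading coefficients multiply as in `U`.
Exactness writes it as a coboundary, and the cochain obtained corrects the lift
(`IsLift.exists_succ`). Since the inverse differential is contracting, each correction costs only a
factor `t > 1` that can be taken arbitrarily close to 1. A factor fixed away from 1 would accumulate
with the order and shrink the disc. The bound `t ^ (2 * a - 1) * η⁻ᵃ` on the coefficient of order
`a` is preserved by the recursion, and for `t² < η/ε` the series converges at radius `ε` and differs
from the inclusion by a map of norm at most `t⁻¹ < 1` (`exists_lie_lift`).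

All defining relations of `U(𝔤)` are Lie relations, the Serre relations being iterated commutators,
so `J` on the generators defines an algebra homomorphism `σ : U(𝔤) → B` (`exists_algHom_of_lie`).
Closeness to constants is multiplicative, hence passes from generators to triangular words, and then
to all of `U(𝔤)` because its seminorm is the gauge of these words (`IsClose.mul`,
`norm_sub_toAn_le`). So `σ` differs from the canonical map by a map of norm at most `q < 1`. It
extends to `U` by continuity and then `ħ`-linearly to an operator `T = id + G` on `U{ħ/ε}` with `‖G‖
≤ q`. Such a `T` is bijective and isometric, and intertwines the undeformed product with the
deformed one; its inverse trivializes the deformation (`exists_algEquiv_of_algHom`). The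
identification of the completed base change with `U{ħ/ε'}` as a module is
`BaseChange.exists_linearEquiv`. -/

namespace Rigidity

noncomputable section

/-! ### Convergent power series: monomials, density and completeness. -/

namespace ConvSeries

section Basic

variable {B : Type*} [NormedRing B] [IsUltrametricDist B] {ε : ℝ}

lemma ext_coeff {f g : ConvSeries B ε} (h : ∀ n, coeff n f = coeff n g) : f = g :=
  toPowerSeries_injective (PowerSeries.ext h)

/-- The coefficient of `ħⁿ` as an additive map. -/
def coeffHom (n : ℕ) : ConvSeries B ε →+ B where
  toFun := coeff n
  map_zero' := by simp [coeff]
  map_add' f g := by simp [coeff]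

@[simp] lemma coeff_add (n : ℕ) (f g : ConvSeries B ε) : coeff n (f + g) = coeff n f + coeff n g :=
  (coeffHom n).map_add f g

@[simp] lemma coeff_sub (n : ℕ) (f g : ConvSeries B ε) : coeff n (f - g) = coeff n f - coeff n g :=
  (coeffHom n).map_sub f g

lemma coeff_sum {ι : Type*} (n : ℕ) (s : Finset ι) (f : ι → ConvSeries B ε) :
    coeff n (∑ i ∈ s, f i) = ∑ i ∈ s, coeff n (f i) :=
  map_sum (coeffHom n) f s

lemma constCoeff_eq (f : ConvSeries B ε) : constCoeff f = coeff 0 f := by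
  simp [constCoeff, coeff]

/-- The monomial `u ħⁿ`. -/
def monomial (n : ℕ) : B →+ ConvSeries B ε where
  toFun u := ⟨PowerSeries.monomial n u, PowerSeries.isRestricted_monomial ε n u⟩
  map_zero' := toPowerSeries_injective (map_zero (PowerSeries.monomial (R := B) n))
  map_add' a b := toPowerSeries_injective (map_add (PowerSeries.monomial (R := B) n) a b)

lemma coeff_monomial (m n : ℕ) (u : B) :
    coeff m (monomial n u : ConvSeries B ε) = if m = n then u else 0 :=
  PowerSeries.coeff_monomial m n u

@[simp] lemma coeff_monomial_same (n : ℕ) (u : B) :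
    coeff n (monomial n u : ConvSeries B ε) = u := by
  simp [coeff_monomial]

lemma monomial_mul_monomial (m n : ℕ) (u v : B) :
    (monomial m u * monomial n v : ConvSeries B ε) = monomial (m + n) (u * v) :=
  toPowerSeries_injective (by
    rw [map_mul]
    exact PowerSeries.monomial_mul_monomial m n u v)

lemma monomial_zero_one : (monomial 0 1 : ConvSeries B ε) = 1 :=
  toPowerSeries_injective (PowerSeries.monomial_zero_eq_C_apply (1 : B))

lemma norm_le_of_forall {f : ConvSeries B ε} {c : ℝ} (h : ∀ n, ‖coeff n f‖ * ε ^ n ≤ c) :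
    ‖f‖ ≤ c :=
  ciSup_le h

variable [hε : Fact (0 < ε)]

lemma norm_monomial (n : ℕ) (u : B) : ‖(monomial n u : ConvSeries B ε)‖ = ‖u‖ * ε ^ n := by
  have hε := hε.out
  refine le_antisymm (norm_le_of_forall fun m => ?_) ?_
  · rw [coeff_monomial]
    split_ifs with h
    · rw [h]
    · rw [norm_zero, zero_mul]; positivity
  · simpa using le_norm (monomial n u : ConvSeries B ε) n

lemma norm_coeff_le (n : ℕ) (f : ConvSeries B ε) : ‖coeff n f‖ ≤ (ε ^ n)⁻¹ * ‖f‖ := by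
  have := pow_pos hε.out n
  rw [← div_eq_inv_mul, le_div_iff₀ this]
  exact le_norm f n

lemma continuous_coeff (n : ℕ) : Continuous (coeff n : ConvSeries B ε → B) :=
  AddMonoidHomClass.continuous_of_bound (coeffHom n) _ (norm_coeff_le n)

/-- The norm is a supremum of coefficient terms, so a finite partial sum is within `δ` of `f` as
soon as it contains the finitely many indices with `‖coeff n f‖ * ε ^ n` not small. This is what
allows continuous additive maps to be controlled on monomials alone. -/
lemma hasSum_monomial (f : ConvSeries B ε) : HasSum (fun n => monomial n (coeff n f)) f := by
  rw [HasSum, Metric.tendsto_nhds]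
  intro δ hδ
  obtain ⟨N, hN⟩ := eventually_atTop.1 (f.tendsto.eventually (gt_mem_nhds (half_pos hδ)))
  filter_upwards [eventually_ge_atTop (Finset.range N)] with s hs
  rw [dist_comm, dist_eq_norm]
  refine (norm_le_of_forall fun n => ?_).trans_lt (half_lt_self hδ)
  rw [coeff_sub, coeff_sum]
  simp only [coeff_monomial, Finset.sum_ite_eq]
  split_ifs with h
  · simpa using (half_pos hδ).le
  · rw [sub_zero]
    refine (hN n ?_).le
    by_contra hn
    exact h (hs (Finset.mem_range.2 (not_le.1 hn)))

/-- Bounds and equality of continuous additive maps can be checked on monomials. -/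
lemma norm_map_le_of_monomial {W : Type*} [SeminormedAddCommGroup W] [IsUltrametricDist W]
    (f : ConvSeries B ε →+ W) (hf : Continuous f) {c : ℝ} (hc : 0 ≤ c)
    (h : ∀ n u, ‖f (monomial n u)‖ ≤ c * (‖u‖ * ε ^ n)) (x : ConvSeries B ε) :
    ‖f x‖ ≤ c * ‖x‖ := by
  have h1 := ((hasSum_monomial x).map f hf).norm
  refine le_of_tendsto h1 (Eventually.of_forall fun s => ?_)
  refine IsUltrametricDist.norm_sum_le_of_forall_le_of_nonneg
    (mul_nonneg hc (norm_nonneg x)) fun n _ => ?_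
  exact (h n _).trans (mul_le_mul_of_nonneg_left (le_norm x n) hc)

lemma map_eq_of_monomial {W : Type*} [AddCommGroup W] [TopologicalSpace W] [T2Space W]
    {f g : ConvSeries B ε →+ W} (hf : Continuous f) (hg : Continuous g)
    (h : ∀ n u, f (monomial n u) = g (monomial n u)) (x : ConvSeries B ε) : f x = g x := by
  have h1 := (hasSum_monomial x).map f hf
  have h2 := (hasSum_monomial x).map g hg
  have : (f ∘ fun n => monomial n (coeff n x)) = g ∘ fun n => monomial n (coeff n x) :=
    funext fun n => h n _
  rw [this] at h1
  exact h1.unique h2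

instance [CompleteSpace B] : CompleteSpace (ConvSeries B ε) := by
  refine Metric.complete_of_cauchySeq_tendsto fun f hf => ?_
  have hcoeff : ∀ n, CauchySeq fun i => coeff n (f i) := fun n =>
    hf.map (AddMonoidHomClass.uniformContinuous_of_bound (coeffHom n) _ (norm_coeff_le n))
  choose b hb using fun n => cauchySeq_tendsto_of_complete (hcoeff n)
  -- Coefficientwise convergence is uniform for the weighted norm; this gives both the decay of the
  -- limit coefficients and convergence in norm.
  have key : ∀ δ > 0, ∃ N, ∀ i ≥ N, ∀ n, ‖coeff n (f i) - b n‖ * ε ^ n ≤ δ := by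
    intro δ hδ
    obtain ⟨N, hN⟩ := Metric.cauchySeq_iff.1 hf δ hδ
    refine ⟨N, fun i hi n => ?_⟩
    refine le_of_tendsto (((tendsto_const_nhds.sub (hb n)).norm).mul_const _)
      (eventually_atTop.2 ⟨N, fun j hj => ?_⟩)
    have := hN i hi j hj
    rw [dist_eq_norm] at this
    rw [← coeff_sub]
    exact (le_norm _ n).trans this.le
  have htend : Tendsto (fun n => ‖PowerSeries.coeff n (PowerSeries.mk b)‖ * ε ^ n) atTop (𝓝 0) := by
    rw [Metric.tendsto_atTop]
    intro δ hδ
    obtain ⟨N, hN⟩ := key (δ / 2) (half_pos hδ)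
    obtain ⟨M, hM⟩ := eventually_atTop.1 ((f N).tendsto.eventually (gt_mem_nhds (half_pos hδ)))
    refine ⟨M, fun n hn => ?_⟩
    have hpos := pow_pos hε.out n
    rw [PowerSeries.coeff_mk, Real.dist_eq, sub_zero, abs_of_nonneg (by positivity)]
    have h1 : ‖b n‖ ≤ max ‖coeff n (f N)‖ ‖coeff n (f N) - b n‖ := by
      have := IsUltrametricDist.norm_add_le_max (coeff n (f N)) (b n - coeff n (f N))
      rwa [add_sub_cancel, norm_sub_rev] at this
    refine (mul_le_mul_of_nonneg_right h1 hpos.le).trans_lt ?_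
    rw [max_mul_of_nonneg _ _ hpos.le]
    exact (max_le (hM n hn).le (hN N le_rfl n)).trans_lt (half_lt_self hδ)
  refine ⟨mk _ htend, ?_⟩
  rw [Metric.tendsto_atTop]
  intro δ hδ
  obtain ⟨N, hN⟩ := key (δ / 2) (half_pos hδ)
  refine ⟨N, fun i hi => ?_⟩
  rw [dist_eq_norm]
  refine (norm_le_of_forall fun n => ?_).trans_lt (half_lt_self hδ)
  rw [coeff_sub]
  convert hN i hi n using 4
  exact PowerSeries.coeff_mk n b

end Basic

/-! ### Scalars `k{ħ/ε}`, division by `ħ` and `ħ`-linear extension. -/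

section Scalars

variable {k : Type*} [NormedField k] [IsUltrametricDist k] {ε : ℝ} [hε : Fact (0 < ε)]

lemma algebraMap_eq_monomial (a : k) :
    algebraMap k (ConvSeries k ε) a = monomial 0 a :=
  toPowerSeries_injective (PowerSeries.monomial_zero_eq_C_apply a).symm

lemma hbar_pow (n : ℕ) : hbar k ε ^ n = monomial n 1 := by
  induction n with
  | zero => rw [pow_zero, monomial_zero_one]
  | succ n ih =>
    have : hbar k ε = monomial 1 1 := rfl
    rw [pow_succ, ih, this, monomial_mul_monomial, mul_one]

lemma monomial_eq (n : ℕ) (a : k) :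
    (monomial n a : ConvSeries k ε) = hbar k ε ^ n * algebraMap k (ConvSeries k ε) a := by
  rw [hbar_pow, algebraMap_eq_monomial, monomial_mul_monomial, one_mul, add_zero]

lemma norm_hbar_pow (n : ℕ) : ‖hbar k ε ^ n‖ = ε ^ n := by
  rw [hbar_pow, norm_monomial, norm_one, one_mul]

variable {I Φ : Type*} [AddCommGroup Φ] [Module.Free ℤ Φ] {R : RootDatum I Φ} {ρ : Radii}

lemma smul_def (c : ConvSeries k ε) (x : ConvSeries (EnvAn k R ρ) ε) :
    c • x = mapAlg k (EnvAn k R ρ) ε c * x := rfl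

lemma coeff_smul (n : ℕ) (c : ConvSeries k ε) (x : ConvSeries (EnvAn k R ρ) ε) :
    coeff n (c • x) =
      ∑ p ∈ Finset.HasAntidiagonal.antidiagonal n, coeff p.1 c • coeff p.2 x := by
  rw [smul_def, coeff_mul]
  refine Finset.sum_congr rfl fun p _ => ?_
  rw [Algebra.smul_def]
  congr 1

lemma coeff_algebraMap_smul (n : ℕ) (a : k) (x : ConvSeries (EnvAn k R ρ) ε) :
    coeff n (algebraMap k (ConvSeries k ε) a • x) = a • coeff n x := by
  rw [coeff_smul, Finset.sum_eq_single (0, n)]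
  · rw [algebraMap_eq_monomial, coeff_monomial_same]
  · rintro ⟨i, j⟩ hp hne
    rw [algebraMap_eq_monomial, coeff_monomial, if_neg, zero_smul]
    rintro rfl
    apply hne
    simpa using hp
  · simp

lemma coeff_hbar_pow_smul (m n : ℕ) (x : ConvSeries (EnvAn k R ρ) ε) :
    coeff n (hbar k ε ^ m • x) = if m ≤ n then coeff (n - m) x else 0 := by
  rw [coeff_smul]
  simp only [hbar_pow, coeff_monomial, ite_smul, one_smul, zero_smul]
  split_ifs with h
  · rw [Finset.sum_eq_single (m, n - m)]
    · simp
    · rintro ⟨i, j⟩ hp hne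
      rw [if_neg]
      rintro rfl
      apply hne
      have hp := Finset.HasAntidiagonal.mem_antidiagonal.1 hp
      simp only [Prod.mk.injEq, true_and]
      omega
    · intro hne
      exact absurd (by simp [h]) hne
  · refine Finset.sum_eq_zero fun p hp => if_neg ?_
    have hp := Finset.HasAntidiagonal.mem_antidiagonal.1 hp
    omega

lemma monomial_smul_monomial (m n : ℕ) (a : k) (u : EnvAn k R ρ) :
    (monomial m a : ConvSeries k ε) • (monomial n u : ConvSeries (EnvAn k R ρ) ε) =
      monomial (m + n) (a • u) := by
  rw [monomial_eq, mul_smul]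
  refine ext_coeff fun i => ?_
  rw [coeff_hbar_pow_smul, coeff_algebraMap_smul, coeff_monomial, coeff_monomial]
  split_ifs <;> first | rfl | omega | simp

lemma monomial_eq_smul (n : ℕ) (u : EnvAn k R ρ) :
    (monomial n u : ConvSeries (EnvAn k R ρ) ε) = hbar k ε ^ n • monomial 0 u := by
  rw [hbar_pow, monomial_smul_monomial, one_smul, add_zero]

instance : IsBoundedSMul (ConvSeries k ε) (ConvSeries (EnvAn k R ρ) ε) :=
  IsBoundedSMul.of_norm_smul_le fun c x => by
    refine norm_le_of_forall fun n => ?_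
    have hpos := pow_pos hε.out n
    rw [coeff_smul, ← le_div_iff₀ hpos]
    refine IsUltrametricDist.norm_sum_le_of_forall_le_of_nonneg (by positivity) fun p hp => ?_
    rw [le_div_iff₀ hpos, ← Finset.HasAntidiagonal.mem_antidiagonal.1 hp, pow_add]
    have h1 := le_norm c p.1
    have h2 := le_norm x p.2
    have h3 : 0 ≤ ε := hε.out.le
    calc ‖coeff p.1 c • coeff p.2 x‖ * (ε ^ p.1 * ε ^ p.2)
        ≤ ‖coeff p.1 c‖ * ‖coeff p.2 x‖ * (ε ^ p.1 * ε ^ p.2) := by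
          gcongr; exact norm_smul_le _ _
      _ = (‖coeff p.1 c‖ * ε ^ p.1) * (‖coeff p.2 x‖ * ε ^ p.2) := by ring
      _ ≤ ‖c‖ * ‖x‖ := by gcongr

/-- Division by `ħⁿ`. -/
lemma exists_eq_hbar_pow_smul (n : ℕ) (x : ConvSeries (EnvAn k R ρ) ε)
    (hx : ∀ m < n, coeff m x = 0) :
    ∃ y : ConvSeries (EnvAn k R ρ) ε, x = hbar k ε ^ n • y := by
  have ht : Tendsto (fun m => ‖PowerSeries.coeff m (PowerSeries.mk fun m => coeff (m + n) x)‖ *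
      ε ^ m) atTop (𝓝 0) := by
    have h1 := ((tendsto_add_atTop_iff_nat n).2 x.tendsto).mul_const ((ε ^ n)⁻¹)
    rw [zero_mul] at h1
    refine h1.congr fun m => ?_
    have := pow_pos hε.out n
    rw [PowerSeries.coeff_mk, pow_add]
    field_simp
  refine ⟨mk _ ht, ext_coeff fun m => ?_⟩
  have h' : ∀ i, coeff i (mk _ ht) = coeff (i + n) x := fun i =>
    PowerSeries.coeff_mk i fun m => coeff (m + n) x
  rw [coeff_hbar_pow_smul]
  split_ifs with h
  · rw [h', Nat.sub_add_cancel h]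
  · exact hx m (not_le.1 h)

variable {W : Type*} [NormedAddCommGroup W] [IsUltrametricDist W] [CompleteSpace W]
  [Module (ConvSeries k ε) W] [IsBoundedSMul (ConvSeries k ε) W]

/-- A continuous additive map on `U{ħ/ε}` is `k{ħ/ε}`-linear as soon as it is so on monomials. -/
lemma map_smul_of_monomial {W : Type*} [NormedAddCommGroup W]
    [Module (ConvSeries k ε) W] [IsBoundedSMul (ConvSeries k ε) W]
    {f : ConvSeries (EnvAn k R ρ) ε →+ W} (hf : Continuous f)
    (h : ∀ (m n : ℕ) (a : k) (u : EnvAn k R ρ),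
      f (monomial (m + n) (a • u)) = (monomial m a : ConvSeries k ε) • f (monomial n u))
    (c : ConvSeries k ε) (x : ConvSeries (EnvAn k R ρ) ε) : f (c • x) = c • f x := by
  have h1 : ∀ m a, f ((monomial m a : ConvSeries k ε) • x) =
      (monomial m a : ConvSeries k ε) • f x := fun m a =>
    map_eq_of_monomial (f := f.comp (DistribSMul.toAddMonoidHom (ConvSeries (EnvAn k R ρ) ε)
        (monomial m a : ConvSeries k ε)))
      (g := (DistribSMul.toAddMonoidHom W (monomial m a : ConvSeries k ε)).comp f)
      (hf.comp (continuous_const_smul _)) (hf.const_smul _)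
      (fun n u => by
        change f ((monomial m a : ConvSeries k ε) • monomial n u) =
          (monomial m a : ConvSeries k ε) • f _
        rw [monomial_smul_monomial, h]) x
  exact map_eq_of_monomial
    (f := f.comp (AddMonoidHom.mk' (fun c : ConvSeries k ε => c • x) fun a b => add_smul a b x))
    (g := AddMonoidHom.mk' (fun c : ConvSeries k ε => c • f x) fun a b => add_smul a b _)
    (hf.comp (continuous_id.smul continuous_const)) (continuous_id.smul continuous_const)
    h1 c

/-- The `k{ħ/ε}`-linear extension to `U{ħ/ε}` of a bounded `k`-linear map on `U`. -/
lemma exists_extension (g : EnvAn k R ρ →+ W) {C : ℝ} (hC : 0 ≤ C) (hg : ∀ u, ‖g u‖ ≤ C * ‖u‖)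
    (hsmul : ∀ (a : k) u, g (a • u) = algebraMap k (ConvSeries k ε) a • g u) :
    ∃ G : ConvSeries (EnvAn k R ρ) ε →ₗ[ConvSeries k ε] W,
      (∀ u, G (monomial 0 u) = g u) ∧ ∀ x, ‖G x‖ ≤ C * ‖x‖ := by
  have hterm : ∀ (x : ConvSeries (EnvAn k R ρ) ε) n,
      ‖hbar k ε ^ n • g (coeff n x)‖ ≤ C * (‖coeff n x‖ * ε ^ n) := fun x n => by
    refine (norm_smul_le _ _).trans ?_
    rw [norm_hbar_pow]
    have := pow_pos hε.out n
    calc ε ^ n * ‖g (coeff n x)‖ ≤ ε ^ n * (C * ‖coeff n x‖) := by gcongr; exact hg _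
      _ = _ := by ring
  have hsummable : ∀ x : ConvSeries (EnvAn k R ρ) ε,
      Summable fun n => hbar k ε ^ n • g (coeff n x) := fun x => by
    -- In a complete ultrametric group, terms tending to zero suffice for summability.
    refine NonarchimedeanAddGroup.summable_of_tendsto_cofinite_zero ?_
    rw [Nat.cofinite_eq_atTop]
    refine squeeze_zero_norm (hterm x) ?_
    simpa using x.tendsto.const_mul C
  let G₀ : ConvSeries (EnvAn k R ρ) ε →+ W := AddMonoidHom.mk'
    (fun x => ∑' n, hbar k ε ^ n • g (coeff n x)) fun x y => by
      rw [← (hsummable x).tsum_add (hsummable y)]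
      simp [smul_add]
  have hbound : ∀ x, ‖G₀ x‖ ≤ C * ‖x‖ := fun x => by
    refine le_of_tendsto (hsummable x).hasSum.norm (Eventually.of_forall fun s => ?_)
    refine IsUltrametricDist.norm_sum_le_of_forall_le_of_nonneg (by positivity) fun n _ => ?_
    exact (hterm x n).trans (mul_le_mul_of_nonneg_left (le_norm x n) hC)
  have hmono : ∀ n u, G₀ (monomial n u) = hbar k ε ^ n • g u := fun n u => by
    change ∑' m, hbar k ε ^ m • g (coeff m (monomial n u)) = _
    rw [tsum_eq_single n]
    · rw [coeff_monomial_same]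
    · intro m hm
      rw [coeff_monomial, if_neg hm, map_zero, smul_zero]
  refine ⟨{ G₀ with map_smul' := fun c x => ?_ }, fun u => ?_, hbound⟩
  · refine map_smul_of_monomial (AddMonoidHomClass.continuous_of_bound G₀ C hbound) ?_ c x
    intro m n a u
    rw [hmono, hmono, hsmul, monomial_eq, smul_smul, smul_smul]
    congr 1
    ring
  · exact (hmono 0 u).trans (by rw [pow_zero, one_smul])

end Scalars

end ConvSeries

/-! ### Deformed products on `U{ħ/ε}` and the `ħ`-adic filtration. -/

open ConvSeries

/-- A `k{ħ/ε}`-algebra `B` identified as a module with `U{ħ/ε}`, whose product of constants is a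
deformation of the product of `U` with coefficients bounded as on a disc of larger radius `η`. -/
structure Deformation (k : Type*) [NormedField k] [IsUltrametricDist k]
    {I Φ : Type*} [AddCommGroup Φ] [Module.Free ℤ Φ] (R : RootDatum I Φ) (ρ : Radii)
    (ε η : ℝ) [Fact (0 < ε)] (B : Type*) [Ring B] [Algebra (ConvSeries k ε) B] where
  /-- the identification with `U{ħ/ε}` -/
  equiv : B ≃ₗ[ConvSeries k ε] ConvSeries (EnvAn k R ρ) ε
  equiv_one : equiv 1 = 1
  lt : ε < η
  coeff_zero_mul_const : ∀ u v : EnvAn k R ρ,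
    coeff 0 (equiv (equiv.symm (monomial 0 u) * equiv.symm (monomial 0 v))) = u * v
  norm_coeff_mul_const_le : ∀ (n : ℕ) (u v : EnvAn k R ρ),
    ‖coeff n (equiv (equiv.symm (monomial 0 u) * equiv.symm (monomial 0 v)))‖ * η ^ n ≤ ‖u‖ * ‖v‖
  bounded_mul : ∃ C : ℝ, ∀ x y : B, ‖equiv (x * y)‖ ≤ C * ‖equiv x‖ * ‖equiv y‖

namespace Deformation

variable {k : Type*} [NormedField k] [IsUltrametricDist k]
  {I Φ : Type*} [AddCommGroup Φ] [Module.Free ℤ Φ] {R : RootDatum I Φ} {ρ : Radii}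
  {ε η : ℝ} [hε : Fact (0 < ε)] {B : Type*} [Ring B] [Algebra (ConvSeries k ε) B]
  (D : Deformation k R ρ ε η B)

include D in
lemma pos : 0 < η := hε.out.trans D.lt

lemma norm_equiv_mul_const_le (u v : EnvAn k R ρ) :
    ‖D.equiv (D.equiv.symm (monomial 0 u) * D.equiv.symm (monomial 0 v))‖ ≤ ‖u‖ * ‖v‖ :=
  norm_le_of_forall fun n => le_trans
    (mul_le_mul_of_nonneg_left (pow_le_pow_left₀ hε.out.le D.lt.le n) (norm_nonneg _))
    (D.norm_coeff_mul_const_le n u v)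

/-- The difference has no constant term, and a coefficient of order `n ≥ 1` bounded at radius `η`
gains the factor `(ε / η) ^ n ≤ ε / η` at radius `ε`. -/
lemma norm_equiv_mul_const_sub_le (u v : EnvAn k R ρ) :
    ‖D.equiv (D.equiv.symm (monomial 0 u) * D.equiv.symm (monomial 0 v)) - monomial 0 (u * v)‖ ≤
      ε / η * (‖u‖ * ‖v‖) := by
  have h0 := hε.out
  have h1 := D.pos
  have hq : ε / η ≤ 1 := (div_le_one h1).2 D.lt.le
  refine norm_le_of_forall fun n => ?_
  rw [coeff_sub, coeff_monomial]
  split_ifs with hn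
  · rw [hn, D.coeff_zero_mul_const, sub_self, norm_zero, zero_mul]
    positivity
  · rw [sub_zero]
    have h2 : ε ^ n = (ε / η) ^ n * η ^ n := by rw [div_pow]; field_simp
    have h3 := D.norm_coeff_mul_const_le n u v
    have h4 : (ε / η) ^ n ≤ ε / η := pow_le_of_le_one (by positivity) hq hn
    rw [h2, mul_left_comm]
    exact mul_le_mul h4 h3 (by positivity) (by positivity)

lemma symm_monomial (n : ℕ) (u : EnvAn k R ρ) : D.equiv.symm (monomial n u) =
    hbar k ε ^ n • D.equiv.symm (monomial 0 u) := by
  rw [← map_smul, ← monomial_eq_smul]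

/-- Left multiplication on `U{ħ/ε}` obtained from `B`. -/
lemma continuous_mul_left (b : B) :
    Continuous fun x => D.equiv (b * D.equiv.symm x) := by
  obtain ⟨C, hC⟩ := D.bounded_mul
  refine AddMonoidHomClass.continuous_of_bound (D.equiv.toAddMonoidHom.comp
    ((AddMonoidHom.mulLeft b).comp D.equiv.symm.toAddMonoidHom)) (C * ‖D.equiv b‖) fun x => ?_
  simpa using hC b (D.equiv.symm x)

lemma continuous_mul_right (b : B) :
    Continuous fun x => D.equiv (D.equiv.symm x * b) := by
  obtain ⟨C, hC⟩ := D.bounded_mul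
  refine AddMonoidHomClass.continuous_of_bound (D.equiv.toAddMonoidHom.comp
    ((AddMonoidHom.mulRight b).comp D.equiv.symm.toAddMonoidHom)) (C * ‖D.equiv b‖) fun x => ?_
  refine (hC (D.equiv.symm x) b).trans (le_of_eq ?_)
  rw [LinearEquiv.apply_symm_apply]
  ring

/-- The constant in `bounded_mul` is used only for continuity. The bound with constant 1 holds for
products of constants, hence for monomials by `ħ`-linearity, and the ultrametric inequality carries
it to one variable at a time. -/
lemma norm_equiv_mul_le (x y : B) : ‖D.equiv (x * y)‖ ≤ ‖D.equiv x‖ * ‖D.equiv y‖ := by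
  have h0 := hε.out
  have h1 : ∀ m u n v, ‖D.equiv (D.equiv.symm (monomial m u) * D.equiv.symm (monomial n v))‖ ≤
      (‖u‖ * ε ^ m) * (‖v‖ * ε ^ n) := fun m u n v => by
    rw [D.symm_monomial, D.symm_monomial n, smul_mul_smul_comm, map_smul, ← pow_add]
    refine (norm_smul_le _ _).trans ?_
    rw [norm_hbar_pow, pow_add]
    calc _ ≤ ε ^ m * ε ^ n * (‖u‖ * ‖v‖) := by gcongr; exact D.norm_equiv_mul_const_le u v
      _ = _ := by ring
  have h2 : ∀ m u z, ‖D.equiv (D.equiv.symm (monomial m u) * D.equiv.symm z)‖ ≤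
      (‖u‖ * ε ^ m) * ‖z‖ := fun m u z =>
    norm_map_le_of_monomial (D.equiv.toAddMonoidHom.comp
      ((AddMonoidHom.mulLeft _).comp D.equiv.symm.toAddMonoidHom))
      (D.continuous_mul_left _) (by positivity) (h1 m u) z
  have h3 := norm_map_le_of_monomial (D.equiv.toAddMonoidHom.comp
      ((AddMonoidHom.mulRight y).comp D.equiv.symm.toAddMonoidHom))
      (D.continuous_mul_right _) (norm_nonneg (D.equiv y)) (fun m u => by
        have := h2 m u (D.equiv y)
        rw [LinearEquiv.symm_apply_apply] at this
        exact this.trans (le_of_eq (mul_comm _ _))) (D.equiv x)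
  rw [mul_comm]
  simpa using h3

/-- The coefficient of `ħⁿ` of an element of `B`. -/
def coeff (n : ℕ) : B →+ EnvAn k R ρ := (coeffHom n).comp D.equiv.toAddMonoidHom

lemma coeff_apply (n : ℕ) (b : B) : D.coeff n b = ConvSeries.coeff n (D.equiv b) := rfl

lemma coeff_hbar_pow_smul (m n : ℕ) (b : B) :
    D.coeff n (hbar k ε ^ m • b) = if m ≤ n then D.coeff (n - m) b else 0 := by
  simp only [coeff_apply, map_smul, ConvSeries.coeff_hbar_pow_smul]

lemma exists_eq_hbar_pow_smul (n : ℕ) (b : B) (h : ∀ m < n, D.coeff m b = 0) :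
    ∃ c, b = hbar k ε ^ n • c := by
  obtain ⟨y, hy⟩ := ConvSeries.exists_eq_hbar_pow_smul n (D.equiv b) h
  exact ⟨D.equiv.symm y, by rw [← map_smul, ← hy, LinearEquiv.symm_apply_apply]⟩

/-- Each element is a constant plus a multiple of `ħ`, and the multiples of `ħ` do not contribute to
the constant term of the product. -/
lemma coeff_zero_mul (x y : B) : D.coeff 0 (x * y) = D.coeff 0 x * D.coeff 0 y := by
  have h : ∀ z : B, ∃ c, z = D.equiv.symm (monomial 0 (D.coeff 0 z)) + hbar k ε ^ 1 • c := by
    intro z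
    obtain ⟨c, hc⟩ := D.exists_eq_hbar_pow_smul 1
      (z - D.equiv.symm (monomial 0 (D.coeff 0 z))) fun m hm => by
        obtain rfl : m = 0 := by omega
        rw [map_sub, coeff_apply _ _ (D.equiv.symm _), LinearEquiv.apply_symm_apply,
          coeff_monomial_same, sub_self]
    exact ⟨c, by rw [← hc, add_sub_cancel]⟩
  obtain ⟨c, hc⟩ := h x
  obtain ⟨d, hd⟩ := h y
  conv_lhs => rw [hc, hd]
  rw [add_mul, mul_add, smul_mul_assoc, mul_smul_comm, map_add, map_add, D.coeff_hbar_pow_smul,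
    D.coeff_hbar_pow_smul]
  simp [coeff_apply, D.coeff_zero_mul_const]

/-- The elements of `ħⁿB`. -/
def order (n : ℕ) : AddSubgroup B := ⨅ m : Fin n, (D.coeff m).ker

lemma mem_order {n : ℕ} {b : B} : b ∈ D.order n ↔ ∀ m < n, D.coeff m b = 0 := by
  simp only [order, AddSubgroup.mem_iInf, AddMonoidHom.mem_ker]
  exact ⟨fun h m hm => h ⟨m, hm⟩, fun h m => h m m.2⟩

lemma mem_order_iff_exists {n : ℕ} {b : B} : b ∈ D.order n ↔ ∃ c, b = hbar k ε ^ n • c := by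
  refine ⟨fun h => D.exists_eq_hbar_pow_smul n b (D.mem_order.1 h), ?_⟩
  rintro ⟨c, rfl⟩
  refine D.mem_order.2 fun m hm => ?_
  rw [D.coeff_hbar_pow_smul, if_neg (not_le.2 hm)]

lemma hbar_pow_smul_mem_order (n : ℕ) (b : B) : hbar k ε ^ n • b ∈ D.order n :=
  D.mem_order_iff_exists.2 ⟨b, rfl⟩

variable {D}

lemma lie_mem_order {n : ℕ} {a b : B} (hb : b ∈ D.order n) : ⁅a, b⁆ ∈ D.order n := by
  obtain ⟨c, rfl⟩ := D.mem_order_iff_exists.1 hb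
  rw [Ring.lie_def, mul_smul_comm, smul_mul_assoc, ← smul_sub]
  exact D.hbar_pow_smul_mem_order n _

/-- Leading coefficients multiply as in `U`. In the obstruction theory this turns the bracket with a
lift of `x` into the action of `x` on `U`. -/
lemma coeff_lie_of_mem_order {n : ℕ} {a b : B} (hb : b ∈ D.order n) :
    D.coeff n ⁅a, b⁆ = ⁅D.coeff 0 a, D.coeff n b⁆ := by
  obtain ⟨c, rfl⟩ := D.mem_order_iff_exists.1 hb
  rw [Ring.lie_def, mul_smul_comm, smul_mul_assoc, ← smul_sub, D.coeff_hbar_pow_smul,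
    D.coeff_hbar_pow_smul, if_pos le_rfl, if_pos le_rfl, tsub_self, map_sub, D.coeff_zero_mul,
    D.coeff_zero_mul]
  rfl

variable (D)

variable [Algebra k B] [IsScalarTower k (ConvSeries k ε) B]

lemma coeff_smul (n : ℕ) (a : k) (b : B) : D.coeff n (a • b) = a • D.coeff n b := by
  rw [← algebraMap_smul (ConvSeries k ε) a b, coeff_apply, map_smul, coeff_algebraMap_smul,
    coeff_apply]

/-- The constants `U → B`, as a linear map. -/
def const : EnvAn k R ρ →ₗ[k] B where
  toFun u := D.equiv.symm (monomial 0 u)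
  map_add' u v := by rw [map_add, map_add]
  map_smul' a u := by
    rw [RingHom.id_apply, ← algebraMap_smul (ConvSeries k ε) a (D.equiv.symm (monomial 0 u)),
      ← map_smul, algebraMap_eq_monomial, monomial_smul_monomial]

lemma equiv_const (u : EnvAn k R ρ) : D.equiv (D.const u) = monomial 0 u :=
  D.equiv.apply_symm_apply _

lemma coeff_const (n : ℕ) (u : EnvAn k R ρ) : D.coeff n (D.const u) = if n = 0 then u else 0 := by
  rw [coeff_apply, equiv_const, coeff_monomial]

/-! ### Truncated lifts and their defect. -/

section Lift

variable {L : LieSubalgebra k (EnvAn k R ρ)}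

/-- The truncated lift `∑_{a < n} f_a ħᵃ`. -/
def partialLift (f : ℕ → L →ₗ[k] EnvAn k R ρ) (n : ℕ) : L →ₗ[k] B where
  toFun x := ∑ a ∈ Finset.range n, hbar k ε ^ a • D.const (f a x)
  map_add' x y := by simp [smul_add, Finset.sum_add_distrib]
  map_smul' c x := by
    simp only [map_smul, RingHom.id_apply, Finset.smul_sum]
    refine Finset.sum_congr rfl fun a _ => ?_
    rw [← algebraMap_smul (ConvSeries k ε) c, ← algebraMap_smul (ConvSeries k ε) c, smul_comm]

lemma partialLift_apply (f : ℕ → L →ₗ[k] EnvAn k R ρ) (n : ℕ) (x : L) :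
    D.partialLift f n x = ∑ a ∈ Finset.range n, hbar k ε ^ a • D.const (f a x) := rfl

lemma partialLift_succ (f : ℕ → L →ₗ[k] EnvAn k R ρ) (n : ℕ) (x : L) :
    D.partialLift f (n + 1) x = D.partialLift f n x + hbar k ε ^ n • D.const (f n x) :=
  Finset.sum_range_succ _ _

lemma partialLift_congr {f g : ℕ → L →ₗ[k] EnvAn k R ρ} {n : ℕ} (h : ∀ a < n, f a = g a) :
    D.partialLift f n = D.partialLift g n :=
  LinearMap.ext fun x => by
    rw [partialLift_apply, partialLift_apply]
    exact Finset.sum_congr rfl fun a ha => by rw [h a (Finset.mem_range.1 ha)]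

lemma coeff_partialLift (f : ℕ → L →ₗ[k] EnvAn k R ρ) (n m : ℕ) (x : L) :
    D.coeff m (D.partialLift f n x) = if m < n then f m x else 0 := by
  have h : ∀ a, D.coeff m (hbar k ε ^ a • D.const (f a x)) = if m = a then f a x else 0 := by
    intro a
    rw [coeff_hbar_pow_smul, coeff_const]
    split_ifs <;> first | rfl | omega
  simp only [partialLift_apply, map_sum, h, Finset.sum_ite_eq, Finset.mem_range]

/-- The defect of a linear map into `B` to be a homomorphism of Lie algebras. -/
def defect (J : L →ₗ[k] B) (x y : L) : B := ⁅J x, J y⁆ - J ⁅x, y⁆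

/-- After expansion, the double commutators cancel by the Jacobi identity in the associative ring
`B`, the mixed terms cancel in pairs, and what remains is `J` of the Jacobi expression in `L`. The
identity needs no smallness of the defect; its leading coefficient will be the cocycle equation. -/
lemma defect_cocycle (J : L →ₗ[k] B) (x y z : L) :
    ⁅J x, defect J y z⁆ - ⁅J y, defect J x z⁆ + ⁅J z, defect J x y⁆ - defect J ⁅x, y⁆ z +
      defect J ⁅x, z⁆ y - defect J ⁅y, z⁆ x = 0 := by
  have h1 : J ⁅⁅x, y⁆, z⁆ - J ⁅⁅x, z⁆, y⁆ + J ⁅⁅y, z⁆, x⁆ = 0 := by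
    rw [← map_sub, ← map_add]
    convert map_zero J using 2
    have := lie_jacobi x y z
    rw [← lie_skew ⁅x, y⁆ z, ← lie_skew ⁅y, z⁆ x, ← lie_skew ⁅x, z⁆ y, ← lie_skew x z, lie_neg]
    rw [← neg_eq_zero, ← this]
    abel
  rw [← h1]
  simp only [defect, Ring.lie_def]
  noncomm_ring

end Lift

end Deformation

/-! ### Bounded cochains and primitives with controlled norm. -/

section Cochains

open LieModule.Cohomology

variable {k L M : Type*} [Field k] [LieRing L] [LieAlgebra k L] [Norm L]
  [NormedAddCommGroup M] [Module k M]

lemma IsBounded₁.norm_apply_le (hL : ∀ x : L, 0 ≤ ‖x‖) {f : oneCochain k L M}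
    (hf : IsBounded₁ f) (x : L) :
    ‖f x‖ ≤ norm₁ f * ‖x‖ := by
  obtain ⟨C, hC⟩ := hf
  have hne : {C : ℝ | 0 ≤ C ∧ ∀ x, ‖f x‖ ≤ C * ‖x‖}.Nonempty :=
    ⟨max C 0, le_max_right _ _, fun x =>
      (hC x).trans (mul_le_mul_of_nonneg_right (le_max_left _ _) (hL x))⟩
  rcases (hL x).eq_or_lt with h | h
  · have := hC x
    rwa [← h, mul_zero] at this ⊢
  · rw [← div_le_iff₀ h]
    exact le_csInf hne fun c hc => (div_le_iff₀ h).2 (hc.2 x)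

lemma IsBounded₁.add {f g : oneCochain k L M} (hf : IsBounded₁ f) (hg : IsBounded₁ g) :
    IsBounded₁ (f + g) := by
  obtain ⟨C, hC⟩ := hf
  obtain ⟨D, hD⟩ := hg
  refine ⟨C + D, fun x => (norm_add_le (f x) (g x)).trans ?_⟩
  rw [add_mul]
  exact add_le_add (hC x) (hD x)

lemma norm₂_le {f : twoCochain k L M} {C : ℝ} (hC : 0 ≤ C)
    (h : ∀ x y, ‖f x y‖ ≤ C * ‖x‖ * ‖y‖) : norm₂ f ≤ C :=
  csInf_le ⟨0, fun _ h => h.1⟩ ⟨hC, h⟩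

variable [LieRingModule L M] [LieModule k L M]

/-- Bounded cocycles are coboundaries of cochains of almost the same norm. -/
lemma exists_cochain_of_cocycle (hL : ∀ x : L, 0 ≤ ‖x‖) (hexact : StrictlyExactAtTwo k L M)
    (hinv : ContractingInverseAtTwo k L M) (f : twoCochain k L M) (hf : d₂₃ k L M f = 0)
    {C D : ℝ} (hC : 0 ≤ C) (hCD : C < D) (hbound : ∀ x y, ‖f x y‖ ≤ C * ‖x‖ * ‖y‖) :
    ∃ a : oneCochain k L M, (∀ x y, ⁅x, a y⁆ - ⁅y, a x⁆ - a ⁅x, y⁆ = -f x y) ∧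
      ∀ x, ‖a x‖ ≤ D * ‖x‖ := by
  obtain ⟨a, ha, rfl⟩ := hexact.1 f ⟨C, hbound⟩ hf
  -- The quotient norm is an infimum over representatives that need not be attained, which is why
  -- the strict inequality `C < D` is required.
  have h1 : quotNorm₁ a < D := ((hinv a ha).trans (norm₂_le hC hbound)).trans_lt hCD
  have hz : IsBounded₁ (0 : oneCochain k L M) := ⟨0, fun x => by simp⟩
  obtain ⟨_, ⟨z, hz, hdz, rfl⟩, h2⟩ := exists_lt_of_csInf_lt
    (by exact ⟨_, 0, hz, map_zero _, rfl⟩) h1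
  have h3 : d₁₂ k L M (a + z) = d₁₂ k L M a := by rw [map_add, hdz, add_zero]
  -- The sign makes the coboundary of the correction cancel `f`.
  refine ⟨-(a + z), fun x y => ?_, fun x => ?_⟩
  · rw [← h3, d₁₂_apply_apply]
    simp only [LinearMap.neg_apply, lie_neg]
    abel
  · rw [LinearMap.neg_apply, norm_neg]
    exact ((ha.add hz).norm_apply_le hL x).trans (mul_le_mul_of_nonneg_right h2.le (hL x))

end Cochains

/-! ### Order-by-order lifting of the Lie algebra. -/

namespace Deformation

variable {k : Type*} [NormedField k] [IsUltrametricDist k]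
  {I Φ : Type*} [AddCommGroup Φ] [Module.Free ℤ Φ] {R : RootDatum I Φ} {ρ : Radii}
  {ε η : ℝ} [hε : Fact (0 < ε)] {B : Type*} [Ring B] [Algebra (ConvSeries k ε) B]
  (D : Deformation k R ρ ε η B) [Algebra k B] [IsScalarTower k (ConvSeries k ε) B]
  {L : LieSubalgebra k (EnvAn k R ρ)}

open LieModule.Cohomology

/-- The coefficients `f` define a lift `L → B` of the inclusion `L ⊆ U` which is a homomorphism of
Lie algebras modulo `ħⁿ`, with coefficients that grow in a controlled way. -/
structure IsLift (t : ℝ) (f : ℕ → L →ₗ[k] EnvAn k R ρ) (n : ℕ) : Prop where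
  zero : ∀ x, f 0 x = x
  bound : ∀ a < n, ∀ x, ‖f a x‖ * η ^ a ≤ t ^ (2 * a - 1) * ‖x‖
  defect_mem : ∀ x y, defect (D.partialLift f n) x y ∈ D.order n

variable {D}

lemma IsLift.congr {t : ℝ} {f g : ℕ → L →ₗ[k] EnvAn k R ρ} {n : ℕ} (h : D.IsLift t f n)
    (h0 : g 0 = f 0) (hfg : ∀ a < n, g a = f a) : D.IsLift t g n where
  zero := by rw [h0]; exact h.zero
  bound a ha := by rw [hfg a ha]; exact h.bound a ha
  defect_mem := by rw [D.partialLift_congr hfg]; exact h.defect_mem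

lemma isLift_one {t : ℝ} {f : ℕ → L →ₗ[k] EnvAn k R ρ} (h : ∀ x, f 0 x = x) : D.IsLift t f 1 where
  zero := h
  bound a ha x := by
    -- At `a = 0` the exponent `2 * a - 1` truncates to `0`, so the bound on the inclusion itself
    -- has constant 1.
    obtain rfl : a = 0 := by omega
    rw [h]
    simp
  defect_mem x y := by
    refine D.mem_order.2 fun m hm => ?_
    obtain rfl : m = 0 := by omega
    simp only [defect, Ring.lie_def, map_sub, D.coeff_zero_mul, D.coeff_partialLift, h,
      zero_lt_one, if_true]
    rw [LieSubalgebra.coe_bracket, sub_eq_zero]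
    rfl

/-- The powers of `η` add up exactly to `η ^ n`, and `(2a - 1) + (2b - 1) ≤ 2n - 2` whenever `a, b <
n` and `a + b ≤ n`. If `a` or `b` is zero its exponent truncates to zero and the strict bound on the
other index is what is used. The exponent thus stays one below the `2n - 1` allowed for the next
coefficient. -/
lemma IsLift.norm_coeff_mul_le {t : ℝ} (ht : 1 ≤ t) {f : ℕ → L →ₗ[k] EnvAn k R ρ} {n : ℕ}
    (h : D.IsLift t f n) (x y : L) :
    ‖D.coeff n (D.partialLift f n x * D.partialLift f n y)‖ ≤
      t ^ (2 * n - 2) * (η ^ n)⁻¹ * ‖x‖ * ‖y‖ := by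
  have hη := D.pos
  have ht0 : 0 < t := zero_lt_one.trans_le ht
  rw [partialLift_apply, partialLift_apply, Finset.sum_mul_sum, map_sum]
  refine IsUltrametricDist.norm_sum_le_of_forall_le_of_nonneg (by positivity) fun a ha => ?_
  rw [map_sum]
  refine IsUltrametricDist.norm_sum_le_of_forall_le_of_nonneg (by positivity) fun b hb => ?_
  rw [Finset.mem_range] at ha hb
  rw [smul_mul_smul_comm, ← pow_add, coeff_hbar_pow_smul]
  split_ifs with hab
  · have h1 := D.norm_coeff_mul_const_le (n - (a + b)) (f a x) (f b y)
    have h2 : η ^ n = η ^ (n - (a + b)) * (η ^ a * η ^ b) := by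
      rw [← pow_add, ← pow_add, Nat.sub_add_cancel hab]
    have h3 : t ^ (2 * a - 1) * t ^ (2 * b - 1) ≤ t ^ (2 * n - 2) := by
      rw [← pow_add]
      exact pow_le_pow_right₀ ht (by omega)
    rw [mul_assoc, mul_assoc, mul_left_comm, inv_mul_eq_div, le_div_iff₀ (by positivity), h2,
      ← mul_assoc]
    refine (mul_le_mul_of_nonneg_right h1 (by positivity)).trans ?_
    calc ‖f a x‖ * ‖f b y‖ * (η ^ a * η ^ b) = (‖f a x‖ * η ^ a) * (‖f b y‖ * η ^ b) := by ring
      _ ≤ (t ^ (2 * a - 1) * ‖x‖) * (t ^ (2 * b - 1) * ‖y‖) :=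
        mul_le_mul (h.bound a ha x) (h.bound b hb y) (by positivity) (by positivity)
      _ = (t ^ (2 * a - 1) * t ^ (2 * b - 1)) * (‖x‖ * ‖y‖) := by ring
      _ ≤ t ^ (2 * n - 2) * (‖x‖ * ‖y‖) := by gcongr
  · rw [norm_zero]; positivity

/-- The obstruction to lift modulo `ħⁿ⁺¹`. -/
def obstruction (D : Deformation k R ρ ε η B) (f : ℕ → L →ₗ[k] EnvAn k R ρ) (n : ℕ) :
    twoCochain k L (EnvAn k R ρ) where
  val := LinearMap.mk₂ k (fun x y => D.coeff n (defect (D.partialLift f n) x y))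
    (fun x y z => by
      rw [← map_add]; congr 1
      simp only [defect, Ring.lie_def, map_add, add_lie]; noncomm_ring)
    (fun c x y => by
      rw [← D.coeff_smul]; congr 1
      simp only [defect, Ring.lie_def, map_smul, smul_lie, smul_sub, smul_mul_assoc,
        mul_smul_comm])
    (fun x y z => by
      rw [← map_add]; congr 1
      simp only [defect, Ring.lie_def, map_add, lie_add]; noncomm_ring)
    (fun c x y => by
      rw [← D.coeff_smul]; congr 1
      simp only [defect, Ring.lie_def, map_smul, lie_smul, smul_sub, smul_mul_assoc,
        mul_smul_comm])
  property x := by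
    change D.coeff n (defect _ x x) = 0
    rw [defect, lie_self, map_zero, Ring.lie_def, sub_self, sub_zero, map_zero]

lemma obstruction_apply (f : ℕ → L →ₗ[k] EnvAn k R ρ) (n : ℕ) (x y : L) :
    D.obstruction f n x y = D.coeff n (defect (D.partialLift f n) x y) := rfl

lemma IsLift.coeff_zero_partialLift {t : ℝ} {f : ℕ → L →ₗ[k] EnvAn k R ρ} {n : ℕ} (hn : 0 < n)
    (h : D.IsLift t f n) (x : L) : D.coeff 0 (D.partialLift f n x) = x := by
  rw [D.coeff_partialLift, if_pos hn, h.zero]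

lemma IsLift.coeff_lie_defect {t : ℝ} {f : ℕ → L →ₗ[k] EnvAn k R ρ} {n : ℕ} (hn : 0 < n)
    (h : D.IsLift t f n) (x y z : L) :
    D.coeff n ⁅D.partialLift f n x, defect (D.partialLift f n) y z⁆ =
      ⁅x, D.obstruction f n y z⁆ := by
  rw [coeff_lie_of_mem_order (h.defect_mem y z), h.coeff_zero_partialLift hn, obstruction_apply]
  rfl

/-- This is the `ħⁿ`-coefficient of `defect_cocycle`: the defects lie in `ħⁿB`, so bracketing with a
lift of `x` only sees its constant term `x`. The hypothesis `0 < n` ensures that the truncated lift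
has that constant term. -/
lemma IsLift.obstruction_cocycle {t : ℝ} {f : ℕ → L →ₗ[k] EnvAn k R ρ} {n : ℕ} (hn : 0 < n)
    (h : D.IsLift t f n) : d₂₃ k L (EnvAn k R ρ) (D.obstruction f n) = 0 := by
  ext x y z
  rw [d₂₃_apply, ← h.coeff_lie_defect hn, ← h.coeff_lie_defect hn, ← h.coeff_lie_defect hn,
    obstruction_apply, obstruction_apply, obstruction_apply, ← map_sub, ← map_add, ← map_sub,
    ← map_add, ← map_sub, defect_cocycle, map_zero]
  rfl

/-- The truncated lift of the bracket has no term of order `n`, so only the two products of the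
commutator contribute, and the ultrametric inequality takes their maximum instead of their sum. -/
lemma IsLift.norm_obstruction_le {t : ℝ} (ht : 1 ≤ t) {f : ℕ → L →ₗ[k] EnvAn k R ρ} {n : ℕ}
    (h : D.IsLift t f n) (x y : L) :
    ‖D.obstruction f n x y‖ ≤ t ^ (2 * n - 2) * (η ^ n)⁻¹ * ‖x‖ * ‖y‖ := by
  rw [obstruction_apply, defect, map_sub, D.coeff_partialLift, if_neg (lt_irrefl n), sub_zero,
    Ring.lie_def, sub_eq_add_neg, map_add, map_neg]
  refine (IsUltrametricDist.norm_add_le_max _ _).trans (max_le (h.norm_coeff_mul_le ht x y) ?_)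
  rw [norm_neg]
  exact (h.norm_coeff_mul_le ht y x).trans (le_of_eq (by ring))

/-- The correction of order `n` is a cochain whose coboundary kills the obstruction. The spare
factor `t` between the exponents `2n - 2` and `2n - 1` pays for choosing an almost optimal
representative. -/
lemma IsLift.exists_succ (hexact : StrictlyExactAtTwo k L (EnvAn k R ρ))
    (hinv : ContractingInverseAtTwo k L (EnvAn k R ρ)) {t : ℝ} (ht : 1 < t)
    {f : ℕ → L →ₗ[k] EnvAn k R ρ} {n : ℕ} (hn : 0 < n) (h : D.IsLift t f n) :
    ∃ g, D.IsLift t (Function.update f n g) (n + 1) := by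
  have hη := pow_pos D.pos n
  have ht0 : 0 < t := zero_lt_one.trans ht
  obtain ⟨g, hg, hgb⟩ := exists_cochain_of_cocycle 
    (C := t ^ (2 * n - 2) * (η ^ n)⁻¹) (D := t ^ (2 * n - 1) * (η ^ n)⁻¹)
    (fun x : L => norm_nonneg (x : EnvAn k R ρ)) hexact hinv (D.obstruction f n)
    (h.obstruction_cocycle hn) (by positivity)
    (mul_lt_mul_of_pos_right (pow_lt_pow_right₀ ht (by omega)) (by positivity))
    (h.norm_obstruction_le ht.le)
  have hfa : ∀ a < n, Function.update f n g a = f a := fun a ha =>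
    Function.update_of_ne ha.ne _ _
  refine ⟨g, ⟨?_, fun a ha x => ?_, fun x y => ?_⟩⟩
  · rw [hfa 0 hn]; exact h.zero
  · rcases Nat.lt_succ_iff_lt_or_eq.1 ha with ha | rfl
    · rw [hfa a ha]; exact h.bound a ha x
    · rw [Function.update_self, ← le_div_iff₀ hη]
      exact (hgb x).trans (le_of_eq (by ring))
  · set J := D.partialLift f n with hJ
    set J' := D.partialLift (Function.update f n g) (n + 1) with hJ'
    have hJJ : ∀ x, J' x = J x + hbar k ε ^ n • D.const (g x) := fun x => by
      rw [hJ', partialLift_succ, D.partialLift_congr hfa, Function.update_self]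
    have hc0 : ∀ x, D.coeff 0 (J' x) = x := fun x => by
      rw [hJJ, map_add, h.coeff_zero_partialLift hn, coeff_hbar_pow_smul, if_neg (by omega),
        add_zero]
    have hc0' := h.coeff_zero_partialLift hn
    have hmem : ∀ x, hbar k ε ^ n • D.const (g x) ∈ D.order n := fun x =>
      D.hbar_pow_smul_mem_order n _
    have hcn : ∀ x, D.coeff n (hbar k ε ^ n • D.const (g x)) = g x := fun x => by
      rw [coeff_hbar_pow_smul, if_pos le_rfl, tsub_self, coeff_const, if_pos rfl]
    -- Using `J'` in one bracket and `J` in the other absorbs the term quadratic in the correction,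
    -- so the identity is exact.
    have key : defect J' x y = defect J x y - ⁅J' y, hbar k ε ^ n • D.const (g x)⁆ +
        ⁅J x, hbar k ε ^ n • D.const (g y)⁆ - hbar k ε ^ n • D.const (g ⁅x, y⁆) := by
      have h1 := hJJ x
      have h2 := hJJ y
      rw [← sub_eq_iff_eq_add'] at h1 h2
      rw [← h1, ← h2, defect, defect, hJJ ⁅x, y⁆]
      simp only [Ring.lie_def]
      noncomm_ring
    have hord : defect J' x y ∈ D.order n := by
      rw [key]
      exact sub_mem (add_mem (sub_mem (h.defect_mem x y) (lie_mem_order (hmem x)))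
        (lie_mem_order (hmem y))) (hmem _)
    refine D.mem_order.2 fun m hm => ?_
    rcases Nat.lt_succ_iff_lt_or_eq.1 hm with hm | rfl
    · exact D.mem_order.1 hord m hm
    · rw [key, map_sub, map_add, map_sub, coeff_lie_of_mem_order (hmem x),
        coeff_lie_of_mem_order (hmem y), hcn, hcn, hcn, hc0, hc0']
      have h1 := hg x y
      change ⁅(x : EnvAn k R ρ), g y⁆ - ⁅(y : EnvAn k R ρ), g x⁆ - g ⁅x, y⁆ =
        -(D.coeff m (defect J x y)) at h1
      rw [eq_neg_iff_add_eq_zero] at h1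
      rw [← h1]
      abel

/-- A sequence of coefficients which lifts the inclusion to all orders. -/
lemma exists_isLift (D : Deformation k R ρ ε η B)
    (hexact : StrictlyExactAtTwo k L (EnvAn k R ρ))
    (hinv : ContractingInverseAtTwo k L (EnvAn k R ρ)) {t : ℝ} (ht : 1 < t) :
    ∃ f : ℕ → L →ₗ[k] EnvAn k R ρ, ∀ n, D.IsLift t f (n + 1) := by
  choose! next hnext using fun (n : ℕ) (f : ℕ → L →ₗ[k] EnvAn k R ρ)
    (h : D.IsLift t f (n + 1)) => h.exists_succ hexact hinv ht n.succ_pos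
  -- Stage `n` is correct modulo `ħⁿ⁺¹`, and the next stage changes only the entry `n + 1`. Hence
  -- entry `a` is frozen from stage `a` on, and the diagonal is the required sequence.
  let F : ℕ → ℕ → L →ₗ[k] EnvAn k R ρ := fun n => Nat.rec (fun _ => L.toSubmodule.subtype)
    (fun n f => Function.update f (n + 1) (next n f)) n
  have hsucc : ∀ n, F (n + 1) = Function.update (F n) (n + 1) (next n (F n)) := fun n => rfl
  have hF : ∀ n, D.IsLift t (F n) (n + 1) := fun n => by
    induction n with
    | zero => exact isLift_one fun x => rfl
    | succ n ih => exact hnext n _ ih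
  have hstab : ∀ n a, a ≤ n → F n a = F a a := fun n a ha => by
    induction n, ha using Nat.le_induction with
    | base => rfl
    | succ n hn ih => rw [hsucc, Function.update_of_ne (by omega), ih]
  exact ⟨fun a => F a a, fun n => (hF n).congr (hstab n 0 n.zero_le).symm
    fun a ha => (hstab n a (by omega)).symm⟩

/-- The inclusion of a Lie subalgebra `L ⊆ U` with vanishing second bounded cohomology lifts to a
homomorphism of Lie algebras `L → B` that is close to the inclusion. -/
lemma exists_lie_lift (D : Deformation k R ρ ε η B)
    (hexact : StrictlyExactAtTwo k L (EnvAn k R ρ))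
    (hinv : ContractingInverseAtTwo k L (EnvAn k R ρ)) :
    ∃ (J : L →ₗ[k] B) (q : ℝ), q < 1 ∧ (∀ x y, J ⁅x, y⁆ = ⁅J x, J y⁆) ∧
      (∀ x, D.coeff 0 (J x) = x) ∧
      ∀ x, ‖D.equiv (J x) - monomial 0 (x : EnvAn k R ρ)‖ ≤ q * ‖x‖ := by
  have h0 := hε.out
  have hη := D.pos
  -- With `t = √s` the growth `t ^ (2 * a - 1)` is `t⁻¹ * s ^ a`, and `s < η / ε` makes the
  -- coefficients decay like `(s * ε / η) ^ a` at radius `ε`. The leftover `t⁻¹ < 1` is the distance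
  -- to the inclusion.
  obtain ⟨s, hs, hs'⟩ := exists_between ((one_lt_div h0).2 D.lt)
  have hs0 : 0 < s := zero_lt_one.trans hs
  set t := Real.sqrt s with ht_def
  have ht : 1 < t := by rw [ht_def, Real.lt_sqrt zero_le_one]; simpa using hs
  have ht0 : 0 < t := zero_lt_one.trans ht
  have ht2 : t ^ 2 = s := Real.sq_sqrt hs0.le
  have hp : s * ε / η < 1 := by
    rw [div_lt_one hη]; rwa [lt_div_iff₀ h0] at hs'
  have hp0 : 0 ≤ s * ε / η := by positivity
  obtain ⟨f, hf⟩ := D.exists_isLift hexact hinv ht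
  have hbound : ∀ a, 0 < a → ∀ x, ‖f a x‖ * ε ^ a ≤ t⁻¹ * ‖x‖ * (s * ε / η) ^ a := by
    intro a ha x
    have h1 := (hf a).bound a (by omega) x
    have h2 : t ^ (2 * a - 1) = t⁻¹ * s ^ a := by
      rw [← ht2, ← pow_mul]
      obtain ⟨b, rfl⟩ : ∃ b, a = b + 1 := ⟨a - 1, by omega⟩
      rw [show 2 * (b + 1) - 1 = 2 * b + 1 by omega, show 2 * (b + 1) = 2 * b + 1 + 1 by omega,
        pow_succ t (2 * b + 1)]
      field_simp
    rw [h2] at h1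
    have h3 : ε ^ a = η ^ a * (ε / η) ^ a := by rw [div_pow]; field_simp
    calc ‖f a x‖ * ε ^ a = (‖f a x‖ * η ^ a) * (ε / η) ^ a := by rw [h3]; ring
      _ ≤ t⁻¹ * s ^ a * ‖x‖ * (ε / η) ^ a := by gcongr
      _ = _ := by rw [mul_div_assoc, mul_pow]; ring
  have htend : ∀ x, Tendsto (fun a => ‖PowerSeries.coeff a (PowerSeries.mk fun a => f a x)‖ *
      ε ^ a) atTop (𝓝 0) := fun x => by
    have h1 := (tendsto_pow_atTop_nhds_zero_of_lt_one hp0 hp).const_mul (t⁻¹ * ‖x‖)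
    rw [mul_zero] at h1
    refine squeeze_zero' (Eventually.of_forall fun a => by positivity) ?_ h1
    filter_upwards [eventually_gt_atTop 0] with a ha
    rw [PowerSeries.coeff_mk]
    exact hbound a ha x
  let S : L → ConvSeries (EnvAn k R ρ) ε := fun x => ConvSeries.mk _ (htend x)
  have hS : ∀ x a, ConvSeries.coeff a (S x) = f a x := fun x a =>
    PowerSeries.coeff_mk a fun a => f a x
  have hcoeff : ∀ x a, D.coeff a (D.equiv.symm (S x)) = f a x := fun x a => by
    rw [coeff_apply, LinearEquiv.apply_symm_apply, hS]
  have hext : ∀ {b c : B}, (∀ a, D.coeff a b = D.coeff a c) → b = c := fun h =>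
    D.equiv.injective (ext_coeff h)
  let J : L →ₗ[k] B :=
    { toFun := fun x => D.equiv.symm (S x)
      map_add' := fun x y => hext fun a => by simp only [map_add, hcoeff]
      map_smul' := fun c x => hext fun a => by
        rw [RingHom.id_apply, D.coeff_smul, hcoeff, hcoeff, map_smul] }
  have hJ : ∀ x a, D.coeff a (J x) = f a x := hcoeff
  have hJc0 : ∀ x, D.coeff 0 (J x) = x := fun x => by rw [hJ, (hf 0).zero]
  have hclose : ∀ n x, J x - D.partialLift f n x ∈ D.order n := fun n x =>
    D.mem_order.2 fun m hm => by
      rw [map_sub, hJ, coeff_partialLift, if_pos hm, sub_self]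
  refine ⟨J, t⁻¹, inv_lt_one_of_one_lt₀ ht, fun x y => ?_, hJc0, fun x => ?_⟩
  · symm
    rw [← sub_eq_zero]
    refine hext fun n => ?_
    rw [map_zero]
    set P := D.partialLift f (n + 1) with hP
    -- Modulo `ħⁿ⁺¹` the full series agrees with its truncation `P`, whose defect vanishes to that
    -- order; as `n` is arbitrary, the defect of `J` is zero.
    have key : ⁅J x, J y⁆ - J ⁅x, y⁆ = defect P x y - ⁅J y, J x - P x⁆ + ⁅P x, J y - P y⁆ -
        (J ⁅x, y⁆ - P ⁅x, y⁆) := by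
      simp only [defect, Ring.lie_def]
      noncomm_ring
    refine (D.mem_order (n := n + 1)).1 ?_ n (Nat.lt_succ_self n)
    rw [key]
    exact sub_mem (add_mem (sub_mem ((hf n).defect_mem x y) (lie_mem_order (hclose _ x)))
      (lie_mem_order (hclose _ y))) (hclose _ _)
  · refine norm_le_of_forall fun n => ?_
    change ‖ConvSeries.coeff n (D.equiv (D.equiv.symm (S x)) - _)‖ * _ ≤ _
    rw [LinearEquiv.apply_symm_apply, coeff_sub, hS, coeff_monomial]
    split_ifs with hn
    · rw [hn, (hf 0).zero, sub_self, norm_zero, zero_mul]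
      positivity
    · rw [sub_zero]
      refine (hbound n (Nat.pos_of_ne_zero hn) x).trans ?_
      exact mul_le_of_le_one_right (by positivity) (pow_le_one₀ hp0 hp.le)

end Deformation

/-! ### From Lie homomorphisms to algebra homomorphisms on `U(𝔤)`. -/

/-- The Serre expression is an iterated commutator. -/
lemma serre_eq_iterate {B : Type*} [Ring B] (N : ℕ) (x y : B) :
    serre N x y = (fun z => ⁅x, z⁆)^[N] y := by
  have h1 : (fun z => ⁅x, z⁆) = ⇑(-LinearMap.mulRight ℤ x + LinearMap.mulLeft ℤ x) := by
    ext z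
    change x * z - z * x = -(z * x) + x * z
    abel
  -- Left and right multiplication commute, so the binomial theorem applies. Putting `-R_x` first
  -- gives it the exponent `m`, as in the Serre sum.
  have hc : Commute (-LinearMap.mulRight ℤ x) (LinearMap.mulLeft ℤ x) :=
    (LinearMap.commute_mulLeft_right x x).symm.neg_left
  rw [h1, ← Module.End.coe_pow, hc.add_pow, serre, LinearMap.sum_apply]
  refine Finset.sum_congr rfl fun m _ => ?_
  rw [neg_pow (LinearMap.mulRight ℤ x), LinearMap.pow_mulLeft, LinearMap.pow_mulRight,
    ← nsmul_eq_mul']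
  rcases Nat.even_or_odd m with h | h
  · rw [h.neg_one_pow, h.neg_one_pow]
    simp [mul_assoc, (Nat.cast_commute (N.choose m) (x ^ (N - m))).left_comm]
  · rw [h.neg_one_pow, h.neg_one_pow]
    simp [mul_assoc, (Nat.cast_commute (N.choose m) (x ^ (N - m))).left_comm]

lemma map_serre {B C : Type*} [Ring B] [Ring C] (f : B →+* C) (N : ℕ) (x y : B) :
    f (serre N x y) = serre N (f x) (f y) := by
  simp [serre]

section Env

variable {k : Type*} [NormedField k] [IsUltrametricDist k]
  {I Φ : Type*} [AddCommGroup Φ] [Module.Free ℤ Φ] (R : RootDatum I Φ) (ρ : Radii)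

variable (k) in
/-- The canonical homomorphism `U(𝔤) → U(𝔤)^an`. -/
def toAn : Env k R →ₐ[k] EnvAn k R ρ where
  __ := (UniformSpace.Completion.coeRingHom : EnvTri k R ρ →+* _)
  commutes' _ := rfl

lemma toAn_gen (g : Gen I) : toAn k R ρ (Env.gen k R g) = EnvAn.gen k R ρ g := rfl

lemma norm_toAn (x : Env k R) : ‖toAn k R ρ x‖ = gauge (triGen k R ρ) x :=
  UniformSpace.Completion.norm_coe (E := EnvTri k R ρ) x

lemma norm_gen_le (g : Gen I) : ‖EnvAn.gen k R ρ g‖ ≤ g.weight ρ := by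
  rw [← toAn_gen, norm_toAn]
  refine gauge_le g.weight_pos.le ?_
  cases g with
  | F i => simpa [Env.word, Gen.weight] using word_mem (k := k) (R := R) (ρ := ρ) [i] [] []
  | H i => simpa [Env.word, Gen.weight] using word_mem (k := k) (R := R) (ρ := ρ) [] [i] []
  | E i => simpa [Env.word, Gen.weight] using word_mem (k := k) (R := R) (ρ := ρ) [] [] [i]

lemma norm_one_le : ‖(1 : EnvAn k R ρ)‖ ≤ 1 := by
  rw [← map_one (toAn k R ρ), norm_toAn]
  refine gauge_le zero_le_one ?_
  simpa [Env.word] using word_mem (k := k) (R := R) (ρ := ρ) [] [] []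

lemma gen_mem_lieAn (g : Gen I) : EnvAn.gen k R ρ g ∈ lieAn k R ρ := by
  rw [lieAn, ← SetLike.mem_coe, LieSubalgebra.coe_sInf]
  exact Set.mem_iInter₂.2 fun L hL => hL.2 g

/-- A homomorphism of Lie algebras from `𝔤_{r,s}` to an associative algebra extends to `U(𝔤)`. -/
lemma exists_algHom_of_lie {B : Type*} [Ring B] [Algebra k B] (J : lieAn k R ρ →ₗ[k] B)
    (hJ : ∀ x y, J ⁅x, y⁆ = ⁅J x, J y⁆) :
    ∃ σ : Env k R →ₐ[k] B, ∀ g, σ (Env.gen k R g) =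
      J ⟨EnvAn.gen k R ρ g, gen_mem_lieAn R ρ g⟩ := by
  let e : Gen I → lieAn k R ρ := fun g => ⟨EnvAn.gen k R ρ g, gen_mem_lieAn R ρ g⟩
  let σ₀ : FreeAlgebra k (Gen I) →ₐ[k] B := FreeAlgebra.lift k fun g => J (e g)
  have hσ₀ : ∀ g, σ₀ (FreeAlgebra.ι k g) = J (e g) := fun g => FreeAlgebra.lift_ι_apply _ _
  let π : FreeAlgebra k (Gen I) →ₐ[k] EnvAn k R ρ := (toAn k R ρ).comp (Env.proj k R)
  have hπ : ∀ g, π (FreeAlgebra.ι k g) = e g := fun g => rfl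
  have hrel : ∀ {x y}, Rel k R x y → π x = π y := fun h => congrArg (toAn k R ρ) (gen_rel h)
  -- Each quadratic relation says that a commutator of generators equals an element of `𝔤_{r,s}`, a
  -- statement that `J` transports to `B`.
  have hcomm : ∀ g g' (z : lieAn k R ρ), ⁅(e g : EnvAn k R ρ), (e g' : EnvAn k R ρ)⁆ = z →
      ⁅J (e g), J (e g')⁆ = J z := fun g g' z h => by
    rw [← hJ]; congr 1; exact Subtype.ext h
  have hiter : ∀ N g g', ((fun z => ⁅J (e g), z⁆)^[N]) (J (e g')) =
      J ((fun z => ⁅e g, z⁆)^[N] (e g')) := fun N g g' =>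
    (Function.Semiconj.iterate_right (f := J) (ga := fun z => ⁅e g, z⁆)
      (gb := fun z => ⁅J (e g), z⁆) (fun z => hJ _ z) N (e g')).symm
  have hiter' : ∀ N g g', (((fun z => ⁅e g, z⁆)^[N] (e g') : lieAn k R ρ) : EnvAn k R ρ) =
      (fun z : EnvAn k R ρ => ⁅(e g : EnvAn k R ρ), z⁆)^[N] (e g' : EnvAn k R ρ) := fun N g g' =>
    Function.Semiconj.iterate_right (f := ((↑) : lieAn k R ρ → EnvAn k R ρ))
      (ga := fun z => ⁅e g, z⁆) (gb := fun z => ⁅(e g : EnvAn k R ρ), z⁆) (fun z => rfl) N (e g')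
  -- As an iterated commutator, the Serre expression already vanishes inside the Lie subalgebra,
  -- where `J` can be applied.
  have hS : ∀ N g g', serre N (π (FreeAlgebra.ι k g)) (π (FreeAlgebra.ι k g')) = 0 →
      serre N (J (e g)) (J (e g')) = 0 := fun N g g' h => by
    rw [serre_eq_iterate, hiter]
    rw [hπ, hπ, serre_eq_iterate] at h
    have : (fun z => ⁅e g, z⁆)^[N] (e g') = 0 := Subtype.ext ((hiter' N g g').trans h)
    rw [this, map_zero]
  have hlift : ∀ ⦃x y⦄, Rel k R x y → σ₀ x = σ₀ y := by
    intro x y h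
    have hp := hrel h
    cases h with
    | HH i j =>
      simp only [map_mul, hσ₀, hπ] at hp ⊢
      have := hcomm (.H i) (.H j) 0 (by rw [Ring.lie_def, hp, sub_self]; rfl)
      rwa [map_zero, Ring.lie_def, sub_eq_zero] at this
    | HE i j =>
      simp only [map_mul, map_sub, map_smul, hσ₀, hπ] at hp ⊢
      have := hcomm (.H i) (.E j) (R.pairing k i j • e (.E j)) hp
      rwa [map_smul] at this
    | HF i j =>
      simp only [map_mul, map_sub, map_smul, map_neg, hσ₀, hπ] at hp ⊢
      have := hcomm (.H i) (.F j) (-(R.pairing k i j • e (.F j))) hp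
      rwa [map_neg, map_smul] at this
    | EF_self i =>
      simp only [map_mul, map_sub, hσ₀, hπ] at hp ⊢
      exact hcomm (.E i) (.F i) (e (.H i)) hp
    | EF i j hij =>
      simp only [map_mul, map_sub, map_zero, hσ₀, hπ] at hp ⊢
      have := hcomm (.E i) (.F j) 0 hp
      rwa [map_zero] at this
    | serreE i j hij =>
      have h1 := map_serre (σ₀ : FreeAlgebra k (Gen I) →+* B)
      have h2 := map_serre (π : FreeAlgebra k (Gen I) →+* EnvAn k R ρ)
      simp only [RingHom.coe_coe] at h1 h2
      rw [map_zero] at hp ⊢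
      rw [h2] at hp
      rw [h1, hσ₀, hσ₀]
      exact hS _ _ _ hp
    | serreF i j hij =>
      have h1 := map_serre (σ₀ : FreeAlgebra k (Gen I) →+* B)
      have h2 := map_serre (π : FreeAlgebra k (Gen I) →+* EnvAn k R ρ)
      simp only [RingHom.coe_coe] at h1 h2
      rw [map_zero] at hp ⊢
      rw [h2] at hp
      rw [h1, hσ₀, hσ₀]
      exact hS _ _ _ hp
  exact ⟨RingQuot.liftAlgHom k ⟨σ₀, fun {x y} h => hlift h⟩, fun g =>
    (RingQuot.liftAlgHom_mkAlgHom_apply k σ₀ (fun {x y} h => hlift h) _).trans (hσ₀ g)⟩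

end Env

lemma algHom_ext_gen {k : Type*} [Field k] {I Φ : Type*} [AddCommGroup Φ] [Module.Free ℤ Φ]
    {R : RootDatum I Φ} {B : Type*} [Ring B] [Algebra k B] {f g : Env k R →ₐ[k] B}
    (h : ∀ i, f (Env.gen k R i) = g (Env.gen k R i)) : f = g :=
  RingQuot.ringQuot_ext' k f g (FreeAlgebra.hom_ext (funext h))

/-! ### Extension by continuity and approximation on triangular words. -/

section Env

variable {k : Type*} [NormedField k] [IsUltrametricDist k]
  {I Φ : Type*} [AddCommGroup Φ] [Module.Free ℤ Φ] {R : RootDatum I Φ} {ρ : Radii}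

lemma denseRange_toAn : DenseRange (toAn k R ρ) :=
  UniformSpace.Completion.denseRange_coe (α := EnvTri k R ρ)

/-- Extension by continuity from `U(𝔤)` to `U(𝔤)^an`. -/
lemma exists_extension_toAn {W : Type*} [NormedAddCommGroup W] [CompleteSpace W]
    (f : Env k R →+ W) {q : ℝ} (hf : ∀ x, ‖f x‖ ≤ q * ‖toAn k R ρ x‖) :
    ∃ g : EnvAn k R ρ →+ W, (∀ x, g (toAn k R ρ x) = f x) ∧ ∀ u, ‖g u‖ ≤ q * ‖u‖ := by
  let f₁ : NormedAddGroupHom (EnvTri k R ρ) W :=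
    { toFun := f
      map_add' := f.map_add
      bound' := ⟨q, fun x => (hf x).trans_eq (congrArg (q * ·) (norm_toAn R ρ x))⟩ }
  let g : EnvAn k R ρ →+ W := f₁.extension.toAddMonoidHom
  have hg : Continuous g := f₁.extension.continuous
  have hgf : ∀ x, g (toAn k R ρ x) = f x := fun x => f₁.extension_coe x
  refine ⟨g, hgf, fun u => ?_⟩
  refine denseRange_toAn.induction_on (p := fun u => ‖g u‖ ≤ q * ‖u‖) u
    (isClosed_le hg.norm (continuous_norm.const_mul q)) fun x => ?_
  rw [hgf]
  exact hf x

end Env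

namespace Deformation

variable {k : Type*} [NormedField k] [IsUltrametricDist k]
  {I Φ : Type*} [AddCommGroup Φ] [Module.Free ℤ Φ] {R : RootDatum I Φ} {ρ : Radii}
  {ε η : ℝ} [hε : Fact (0 < ε)] {B : Type*} [Ring B] [Algebra (ConvSeries k ε) B]
  (D : Deformation k R ρ ε η B)

/-- `b` is a good approximation of the constant `u`, relative to the size `c`. -/
structure IsClose (q : ℝ) (b : B) (u : EnvAn k R ρ) (c : ℝ) : Prop where
  left : ‖D.equiv b‖ ≤ c
  right : ‖u‖ ≤ c
  sub : ‖D.equiv b - monomial 0 u‖ ≤ q * c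

variable {D}

/-- Telescoping splits the error into an error in the first factor, one in the second, and the
deviation of the deformed product of two constants from their product in `U`; the last is where `ε /
η ≤ q` enters. The ultrametric inequality keeps `q` unchanged, however long the word. Errors are
measured against a size `c` and not against `‖u‖`, since a word may have norm smaller than its
weight. -/
lemma IsClose.mul {q : ℝ} (hq : ε / η ≤ q) {b b' : B} {u u' : EnvAn k R ρ} {c c' : ℝ}
    (h : D.IsClose q b u c) (h' : D.IsClose q b' u' c') :
    D.IsClose q (b * b') (u * u') (c * c') := by
  have hc : 0 ≤ c := (norm_nonneg _).trans h.left
  have hc' : 0 ≤ c' := (norm_nonneg _).trans h'.left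
  have hη := D.pos
  have h0 := hε.out
  have hq0 : 0 ≤ q := le_trans (by positivity) hq
  refine ⟨(D.norm_equiv_mul_le b b').trans (mul_le_mul h.left h'.left (norm_nonneg _) hc),
    (norm_mul_le u u').trans (mul_le_mul h.right h'.right (norm_nonneg _) hc), ?_⟩
  set s := D.equiv.symm (monomial 0 u)
  set s' := D.equiv.symm (monomial 0 u')
  have hs : D.equiv s = monomial 0 u := D.equiv.apply_symm_apply _
  have hs' : D.equiv s' = monomial 0 u' := D.equiv.apply_symm_apply _
  have key : D.equiv (b * b') - monomial 0 (u * u') =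
      D.equiv ((b - s) * b') + D.equiv (s * (b' - s')) +
        (D.equiv (s * s') - monomial 0 (u * u')) := by
    rw [sub_mul, mul_sub, map_sub, map_sub]; abel
  rw [key]
  have hns : ‖D.equiv s‖ ≤ c := by rw [hs, norm_monomial]; simpa using h.right
  refine (IsUltrametricDist.norm_add_le_max _ _).trans (max_le
    ((IsUltrametricDist.norm_add_le_max _ _).trans (max_le ?_ ?_)) ?_)
  · refine (D.norm_equiv_mul_le _ _).trans ?_
    rw [map_sub, hs, ← mul_assoc]
    exact mul_le_mul h.sub h'.left (norm_nonneg _) (by positivity)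
  · refine (D.norm_equiv_mul_le _ _).trans ?_
    rw [map_sub, hs', mul_left_comm]
    exact mul_le_mul hns h'.sub (norm_nonneg _) (by positivity)
  · exact (D.norm_equiv_mul_const_sub_le u u').trans (mul_le_mul hq
      (mul_le_mul h.right h'.right (norm_nonneg _) hc) (by positivity) hq0)

lemma isClose_one {q : ℝ} (hq : 0 ≤ q) : D.IsClose q 1 1 1 := by
  have h := norm_one_le (k := k) R ρ
  refine ⟨?_, h, ?_⟩
  · rw [D.equiv_one, ← monomial_zero_one, norm_monomial]
    simpa using h
  · rw [D.equiv_one, ← monomial_zero_one, sub_self, norm_zero]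
    simpa using hq

variable (D) [Algebra k B]

lemma isClose_gen {J : lieAn k R ρ →ₗ[k] B} {q : ℝ} (hq0 : 0 ≤ q) (hq1 : q ≤ 1)
    (hJq : ∀ x, ‖D.equiv (J x) - monomial 0 (x : EnvAn k R ρ)‖ ≤ q * ‖x‖)
    {σ : Env k R →ₐ[k] B}
    (hσ : ∀ g, σ (Env.gen k R g) = J ⟨EnvAn.gen k R ρ g, gen_mem_lieAn R ρ g⟩) (g : Gen I) :
    D.IsClose q (σ (Env.gen k R g)) (toAn k R ρ (Env.gen k R g)) (g.weight ρ) := by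
  have hw := norm_gen_le (k := k) R ρ g
  have h1 : ‖D.equiv (σ (Env.gen k R g)) - monomial 0 (toAn k R ρ (Env.gen k R g))‖ ≤
      q * g.weight ρ := by
    rw [hσ, toAn_gen]
    exact (hJq _).trans (mul_le_mul_of_nonneg_left hw hq0)
  refine ⟨?_, hw, h1⟩
  rw [← sub_add_cancel (D.equiv (σ (Env.gen k R g))) (monomial 0 (toAn k R ρ (Env.gen k R g)))]
  refine (IsUltrametricDist.norm_add_le_max _ _).trans (max_le ?_ ?_)
  · exact h1.trans (mul_le_of_le_one_left g.weight_pos.le hq1)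
  · rw [norm_monomial, pow_zero, mul_one]
    exact hw

variable [IsScalarTower k (ConvSeries k ε) B]

/-- Reduction modulo `ħ`, as a homomorphism of algebras. -/
def reduction : B →ₐ[k] EnvAn k R ρ :=
  AlgHom.ofLinearMap { D.coeff 0 with map_smul' := fun a b => D.coeff_smul 0 a b }
    (by
      change D.coeff 0 1 = 1
      rw [coeff_apply, D.equiv_one, ← monomial_zero_one, coeff_monomial_same])
    D.coeff_zero_mul

/-- The norm of `U` is the gauge of triangular words, so an ultrametric, `k`-homogeneous bound by
`q` times the weight of each word gives the same bound by `q` times the norm of every element. -/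
lemma norm_sub_toAn_le {q : ℝ} (hq : ε / η ≤ q) {σ : Env k R →ₐ[k] B}
    (h : ∀ g : Gen I, D.IsClose q (σ (Env.gen k R g)) (toAn k R ρ (Env.gen k R g)) (g.weight ρ))
    (x : Env k R) :
    ‖D.equiv (σ x) - monomial 0 (toAn k R ρ x)‖ ≤ q * ‖toAn k R ρ x‖ := by
  have hη := D.pos
  have h0 := hε.out
  have hq0 : 0 < q := lt_of_lt_of_le (by positivity) hq
  have hlist : ∀ (f : I → Gen I) (w : ℝ), (∀ i, (f i).weight ρ = w) → ∀ l : List I,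
      D.IsClose q (σ (l.map fun i => Env.gen k R (f i)).prod)
        (toAn k R ρ (l.map fun i => Env.gen k R (f i)).prod) (w ^ l.length) := by
    intro f w hw l
    induction l with
    | nil => simpa using isClose_one hq0.le
    | cons i l ih =>
      rw [List.map_cons, List.prod_cons, map_mul, map_mul, List.length_cons, pow_succ', ← hw i]
      refine IsClose.mul hq (h _) ?_
      rw [hw i]
      exact ih
  have hword : ∀ l m n, D.IsClose q (σ (Env.word k R l m n)) (toAn k R ρ (Env.word k R l m n))
      (ρ.r ^ l.length * ρ.s ^ n.length) := by
    intro l m n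
    have := ((hlist .F ρ.r (fun _ => rfl) l).mul hq (hlist .H 1 (fun _ => rfl) m)).mul hq
      (hlist .E ρ.s (fun _ => rfl) n)
    rwa [← map_mul, ← map_mul, ← map_mul, ← map_mul, one_pow, mul_one] at this
  let S : Env k R →+ ConvSeries (EnvAn k R ρ) ε :=
    D.equiv.toAddMonoidHom.comp (σ : Env k R →+ B) -
      (monomial 0).comp (toAn k R ρ : Env k R →+ EnvAn k R ρ)
  have hS : ∀ x, S x = D.equiv (σ x) - monomial 0 (toAn k R ρ x) := fun x => rfl
  have hsmul : ∀ (a : k) x, S (a • x) = algebraMap k (ConvSeries k ε) a • S x := by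
    intro a x
    rw [hS, hS, map_smul σ, map_smul (toAn k R ρ), ← algebraMap_smul (ConvSeries k ε) a (σ x), map_smul,
      smul_sub, algebraMap_eq_monomial, monomial_smul_monomial]
  have key : ∀ c, 0 ≤ c → x ∈ AddSubgroup.closure (triGen k R ρ c) → ‖S x‖ ≤ q * c := by
    intro c hc hx
    have hqc : 0 ≤ q * c := by positivity
    refine AddSubgroup.closure_induction (p := fun x _ => ‖S x‖ ≤ q * c) ?_ ?_ ?_ ?_ hx
    · rintro _ ⟨a, l, m, n, hac, rfl⟩
      rw [hsmul]
      refine (norm_smul_le _ _).trans ?_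
      rw [algebraMap_eq_monomial, norm_monomial, pow_zero, mul_one]
      calc ‖a‖ * ‖S (Env.word k R l m n)‖
          ≤ ‖a‖ * (q * (ρ.r ^ l.length * ρ.s ^ n.length)) := by
            gcongr; exact (hword l m n).sub
        _ = q * (‖a‖ * (ρ.r ^ l.length * ρ.s ^ n.length)) := by ring
        _ ≤ q * c := by gcongr
    · rw [map_zero, norm_zero]; exact hqc
    · intro y z _ _ hy hz
      rw [map_add]
      exact (IsUltrametricDist.norm_add_le_max _ _).trans (max_le hy hz)
    · intro y _ hy
      rwa [map_neg, norm_neg]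
  rw [← hS, norm_toAn, ← div_le_iff₀' hq0]
  refine le_of_forall_gt fun d hd => ?_
  obtain ⟨c, hc0, hcd, hx⟩ := gauge_lt triGen_total hd
  exact ((div_le_iff₀' hq0).2 (key c hc0 hx)).trans_lt hcd

end Deformation

/-! ### Perturbations of the identity and trivialization. -/

/-- A perturbation of the identity of norm less than one is bijective. -/
lemma bijective_id_add_of_norm_le {V : Type*} [NormedAddCommGroup V] [CompleteSpace V]
    (G : V →+ V) {q : ℝ} (hq0 : 0 ≤ q) (hq : q < 1) (hG : ∀ x, ‖G x‖ ≤ q * ‖x‖) :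
    Function.Bijective fun x => x + G x := by
  constructor
  · intro x y hxy
    have h1 : x - y = -(G (x - y)) := by
      rw [map_sub]
      have : x + G x = y + G y := hxy
      rw [neg_sub, sub_eq_sub_iff_add_eq_add, this, add_comm]
    have h2 := hG (x - y)
    rw [← norm_neg (G _), ← h1] at h2
    have h3 : ‖x - y‖ ≤ 0 := by nlinarith [norm_nonneg (x - y)]
    exact sub_eq_zero.1 (norm_le_zero_iff.1 h3)
  · intro y
    -- Solving `x + G x = y` amounts to finding a fixed point of `x ↦ y - G x`.
    have hc : ContractingWith ⟨q, hq0⟩ fun x => y - G x := by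
      refine ⟨hq, LipschitzWith.of_dist_le_mul fun a b => ?_⟩
      rw [dist_eq_norm, dist_comm, dist_eq_norm, sub_sub_sub_cancel_left, ← map_sub]
      exact hG _
    refine ⟨hc.fixedPoint, ?_⟩
    have := hc.fixedPoint_isFixedPt
    rw [Function.IsFixedPt] at this
    exact eq_sub_iff_add_eq.1 this.symm

/-- For `x ≠ 0` the summand `G x` is strictly smaller than `x`, and in an ultrametric space the
larger summand determines the norm. -/
lemma norm_add_map_eq {V : Type*} [NormedAddCommGroup V] [IsUltrametricDist V]
    (G : V →+ V) {q : ℝ} (hq : q < 1) (hG : ∀ x, ‖G x‖ ≤ q * ‖x‖) (x : V) :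
    ‖x + G x‖ = ‖x‖ := by
  rcases eq_or_ne x 0 with rfl | hx
  · simp
  · have hpos := norm_pos_iff.2 hx
    have hlt : ‖G x‖ < ‖x‖ := (hG x).trans_lt (mul_lt_of_lt_one_left hpos hq)
    rw [IsUltrametricDist.norm_add_eq_max_of_norm_ne_norm hlt.ne', max_eq_left hlt.le]

namespace Deformation

variable {k : Type*} [NormedField k] [IsUltrametricDist k]
  {I Φ : Type*} [AddCommGroup Φ] [Module.Free ℤ Φ] {R : RootDatum I Φ} {ρ : Radii}
  {ε η : ℝ} [hε : Fact (0 < ε)] {B : Type*} [Ring B] [Algebra (ConvSeries k ε) B]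
  (D : Deformation k R ρ ε η B)

/-- Equality of bounded biadditive expressions can be checked on monomials. -/
lemma map_mul_of_monomial (T : ConvSeries (EnvAn k R ρ) ε →+ ConvSeries (EnvAn k R ρ) ε)
    (hT : Continuous T)
    (h : ∀ m n u v, T (monomial m u * monomial n v) =
      D.equiv (D.equiv.symm (T (monomial m u)) * D.equiv.symm (T (monomial n v)))) (x y) :
    T (x * y) = D.equiv (D.equiv.symm (T x) * D.equiv.symm (T y)) := by
  have h1 : ∀ m u, T (monomial m u * y) =
      D.equiv (D.equiv.symm (T (monomial m u)) * D.equiv.symm (T y)) := fun m u =>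
    map_eq_of_monomial (f := T.comp (AddMonoidHom.mulLeft (monomial m u)))
      (g := (D.equiv.toAddMonoidHom.comp ((AddMonoidHom.mulLeft
        (D.equiv.symm (T (monomial m u)))).comp D.equiv.symm.toAddMonoidHom)).comp T)
      (hT.comp (continuous_const_mul _)) ((D.continuous_mul_left _).comp hT)
      (fun n v => h m n u v) y
  exact map_eq_of_monomial (f := T.comp (AddMonoidHom.mulRight y))
      (g := (D.equiv.toAddMonoidHom.comp ((AddMonoidHom.mulRight
        (D.equiv.symm (T y))).comp D.equiv.symm.toAddMonoidHom)).comp T)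
      (hT.comp (continuous_mul_const _)) ((D.continuous_mul_right _).comp hT) h1 x

variable [Algebra k B] [IsScalarTower k (ConvSeries k ε) B]

/-- A homomorphism `U(𝔤) → B` close to the canonical map trivializes the deformation. -/
lemma exists_algEquiv_of_algHom (σ : Env k R →ₐ[k] B) {q : ℝ} (hq0 : 0 ≤ q) (hq1 : q < 1)
    (hσ0 : ∀ x, D.coeff 0 (σ x) = toAn k R ρ x)
    (hσ : ∀ x, ‖D.equiv (σ x) - monomial 0 (toAn k R ρ x)‖ ≤ q * ‖toAn k R ρ x‖) :
    ∃ α : B ≃ₐ[ConvSeries k ε] ConvSeries (EnvAn k R ρ) ε,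
      ∀ b, ‖α b‖ = ‖D.equiv b‖ ∧ constCoeff (α b) = constCoeff (D.equiv b) := by
  obtain ⟨S, hS, hSq⟩ := exists_extension_toAn (R := R) (ρ := ρ)
    (D.equiv.toAddMonoidHom.comp (σ : Env k R →+ B) -
      (monomial 0).comp (toAn k R ρ : Env k R →+ EnvAn k R ρ)) hσ
  replace hS : ∀ x, S (toAn k R ρ x) = D.equiv (σ x) - monomial 0 (toAn k R ρ x) := hS
  have hSc : Continuous S := AddMonoidHomClass.continuous_of_bound S q hSq
  have hSsmul : ∀ (a : k) u, S (a • u) = algebraMap k (ConvSeries k ε) a • S u := fun a u => by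
    refine denseRange_toAn.induction_on
      (p := fun u => S (a • u) = algebraMap k (ConvSeries k ε) a • S u) u
      (isClosed_eq (hSc.comp (continuous_const_smul a)) ((continuous_const_smul _).comp hSc))
      fun x => ?_
    rw [← map_smul, hS, hS, map_smul σ, map_smul (toAn k R ρ),
      ← algebraMap_smul (ConvSeries k ε) a (σ x), map_smul, smul_sub, algebraMap_eq_monomial,
      monomial_smul_monomial]
  -- Since `σ` reduces to the canonical map modulo `ħ`, the perturbation is divisible by `ħ`, so `T`
  -- will preserve constant terms.
  have hS0 : ∀ u, ConvSeries.coeff 0 (S u) = 0 := fun u => by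
    refine denseRange_toAn.induction_on (p := fun u => ConvSeries.coeff 0 (S u) = 0) u
      (isClosed_eq ((continuous_coeff 0).comp hSc) continuous_const) fun x => ?_
    rw [hS, coeff_sub, coeff_monomial_same, sub_eq_zero]
    exact hσ0 x
  obtain ⟨G, hG, hGq⟩ := exists_extension S hq0 hSq hSsmul
  let T : ConvSeries (EnvAn k R ρ) ε →ₗ[ConvSeries k ε] ConvSeries (EnvAn k R ρ) ε :=
    LinearMap.id + G
  have hTG : ∀ x, T x = x + G x := fun x => rfl
  have hGc : Continuous G := AddMonoidHomClass.continuous_of_bound G q hGq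
  have hTc : Continuous T := continuous_id.add hGc
  have hTbij : Function.Bijective T := bijective_id_add_of_norm_le G.toAddMonoidHom hq0 hq1 hGq
  have hTnorm : ∀ x, ‖T x‖ = ‖x‖ := norm_add_map_eq G.toAddMonoidHom hq1 hGq
  have hTσ : ∀ x, T (monomial 0 (toAn k R ρ x)) = D.equiv (σ x) := fun x => by
    rw [hTG, hG, hS, add_sub_cancel]
  have hT0 : ∀ x, constCoeff (T x) = constCoeff x := fun x => by
    have : ConvSeries.coeff 0 (G x) = 0 :=
      map_eq_of_monomial (f := (coeffHom 0).comp G.toAddMonoidHom) (g := 0)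
        ((continuous_coeff 0).comp hGc) continuous_const (fun n u => by
          change ConvSeries.coeff 0 (G (monomial n u)) = 0
          rw [monomial_eq_smul (k := k), map_smul, hG, ConvSeries.coeff_hbar_pow_smul]
          split_ifs
          · rw [Nat.zero_sub, hS0]
          · rfl) x
    rw [hTG, constCoeff_eq, constCoeff_eq, coeff_add, this, add_zero]
  have hTone : T 1 = D.equiv 1 := by
    rw [← map_one σ, ← hTσ, map_one (toAn k R ρ), monomial_zero_one]
  let m₀ : EnvAn k R ρ →+ ConvSeries (EnvAn k R ρ) ε := monomial 0
  have hm₀ : Continuous m₀ := AddMonoidHomClass.continuous_of_bound m₀ 1 fun u => by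
    rw [norm_monomial, pow_zero, mul_one, one_mul]
  have hTc₀ : Continuous fun u : EnvAn k R ρ => T (monomial 0 u) := hTc.comp hm₀
  -- On the dense image of `U(𝔤)` this is multiplicativity of `σ`; both sides are continuous in each
  -- variable separately, which suffices.
  have hTmul₀ : ∀ u v : EnvAn k R ρ, T (monomial 0 (u * v)) =
      D.equiv (D.equiv.symm (T (monomial 0 u)) * D.equiv.symm (T (monomial 0 v))) := fun u v => by
    refine denseRange_toAn.induction_on (p := fun u => T (monomial 0 (u * v)) =
      D.equiv (D.equiv.symm (T (monomial 0 u)) * D.equiv.symm (T (monomial 0 v)))) u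
      (isClosed_eq (hTc₀.comp (continuous_mul_const v))
        ((D.continuous_mul_right _).comp hTc₀)) fun x => ?_
    refine denseRange_toAn.induction_on (p := fun v => T (monomial 0 (toAn k R ρ x * v)) =
      D.equiv (D.equiv.symm (T (monomial 0 (toAn k R ρ x))) *
        D.equiv.symm (T (monomial 0 v)))) v
      (isClosed_eq (hTc₀.comp (continuous_const_mul _))
        ((D.continuous_mul_left _).comp hTc₀)) fun y => ?_
    rw [← map_mul, hTσ, hTσ, hTσ, LinearEquiv.symm_apply_apply, LinearEquiv.symm_apply_apply,
      map_mul]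
  have hTmul := D.map_mul_of_monomial T.toAddMonoidHom hTc fun m n u v => by
    change T (monomial m u * monomial n v) =
      D.equiv (D.equiv.symm (T (monomial m u)) * D.equiv.symm (T (monomial n v)))
    rw [monomial_mul_monomial, monomial_eq_smul (k := k) (m + n), monomial_eq_smul (k := k) m u,
      monomial_eq_smul (k := k) n v, map_smul, map_smul, map_smul, map_smul, map_smul, hTmul₀,
      smul_mul_smul_comm, map_smul, pow_add]
  let e := LinearEquiv.ofBijective T hTbij
  have he : ∀ x, e x = T x := fun x => rfl
  have hesymm : ∀ x, T (e.symm x) = x := fun x => e.apply_symm_apply x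
  -- The operator `T` goes from the trivial product to the deformed one, so the trivialization is
  -- `T⁻¹` after the given identification.
  refine ⟨AlgEquiv.ofLinearEquiv (D.equiv.trans e.symm) ?_ ?_, fun b => ⟨?_, ?_⟩⟩
  · change e.symm (D.equiv 1) = 1
    rw [← hTone, ← he, LinearEquiv.symm_apply_apply]
  · intro x y
    change e.symm (D.equiv (x * y)) = e.symm (D.equiv x) * e.symm (D.equiv y)
    rw [LinearEquiv.symm_apply_eq, he]
    refine Eq.trans ?_ (hTmul _ _).symm
    change _ = D.equiv (D.equiv.symm (T (e.symm (D.equiv x))) *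
      D.equiv.symm (T (e.symm (D.equiv y))))
    rw [hesymm, hesymm, LinearEquiv.symm_apply_apply, LinearEquiv.symm_apply_apply]
  · change ‖e.symm (D.equiv b)‖ = _
    rw [← hTnorm, hesymm]
  · change constCoeff (e.symm (D.equiv b)) = _
    rw [← hT0, hesymm]

/-- A deformation of `U(𝔤)^an` over a disc is trivial over a smaller disc if the second bounded
cohomology vanishes with a contracting inverse differential. -/
theorem exists_algEquiv
    (hexact : StrictlyExactAtTwo k (lieAn k R ρ) (EnvAn k R ρ))
    (hinv : ContractingInverseAtTwo k (lieAn k R ρ) (EnvAn k R ρ)) :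
    ∃ α : B ≃ₐ[ConvSeries k ε] ConvSeries (EnvAn k R ρ) ε,
      ∀ b, ‖α b‖ = ‖D.equiv b‖ ∧ constCoeff (α b) = constCoeff (D.equiv b) := by
  have hη := D.pos
  have h0 := hε.out
  obtain ⟨J, q₁, hq₁, hJ, hJ0, hJq⟩ := D.exists_lie_lift hexact hinv
  obtain ⟨σ, hσ⟩ := exists_algHom_of_lie R ρ J hJ
  -- The first entry bounds the error on generators, the second the error that a product introduces.
  set q := max q₁ (ε / η)
  have hq : ε / η ≤ q := le_max_right _ _
  have hq0 : 0 ≤ q := le_trans (by positivity) hq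
  have hq1 : q < 1 := max_lt hq₁ ((div_lt_one hη).2 D.lt)
  -- Reduction modulo `ħ` is an algebra homomorphism, so it suffices to compare on generators.
  have hred : D.reduction.comp σ = toAn k R ρ := algHom_ext_gen fun g => by
    change D.coeff 0 (σ (Env.gen k R g)) = _
    rw [hσ, hJ0, toAn_gen]
  refine D.exists_algEquiv_of_algHom σ hq0 hq1 (fun x => DFunLike.congr_fun hred x)
    (D.norm_sub_toAn_le hq (D.isClose_gen hq0 hq1.le (fun x => (hJq x).trans ?_) hσ))
  exact mul_le_mul_of_nonneg_right (le_max_left _ _) (norm_nonneg (x : EnvAn k R ρ))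

end Deformation

/-! ### Restriction to a smaller disc. -/

namespace ConvSeries

variable {B : Type*} [NormedRing B] [IsUltrametricDist B] {ε ε' : ℝ} [hε' : Fact (0 < ε')]
  [h : Fact (ε' < ε)]

lemma tendsto_of_lt (f : ConvSeries B ε) :
    Tendsto (fun n => ‖PowerSeries.coeff n (toPowerSeries f)‖ * ε' ^ n) atTop (𝓝 0) :=
  squeeze_zero (fun n => mul_nonneg (norm_nonneg _) (pow_nonneg hε'.out.le n))
    (fun n => mul_le_mul_of_nonneg_left (pow_le_pow_left₀ hε'.out.le h.out.le n) (norm_nonneg _))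
    f.tendsto

variable (ε') in
/-- Restriction of convergent power series to a smaller disc. -/
def restrictDisc : ConvSeries B ε →+ ConvSeries B ε' where
  toFun f := mk (toPowerSeries f) (tendsto_of_lt f)
  map_zero' := toPowerSeries_injective (by rw [toPowerSeries_mk, map_zero, map_zero])
  map_add' a b := toPowerSeries_injective (by
    rw [toPowerSeries_mk, map_add, map_add, toPowerSeries_mk, toPowerSeries_mk])

lemma toPowerSeries_restrictDisc (f : ConvSeries B ε) :
    toPowerSeries (restrictDisc ε' f) = toPowerSeries f :=
  toPowerSeries_mk (toPowerSeries f) (tendsto_of_lt f)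

lemma coeff_restrictDisc (n : ℕ) (f : ConvSeries B ε) :
    coeff n (restrictDisc ε' f) = coeff n f :=
  congrArg (PowerSeries.coeff n) (toPowerSeries_restrictDisc f)

lemma restrictDisc_one : restrictDisc ε' (1 : ConvSeries B ε) = 1 :=
  ext_coeff fun n => by
    rw [coeff_restrictDisc, coeff, coeff, map_one toPowerSeries, map_one toPowerSeries]

lemma restrictDisc_monomial (n : ℕ) (u : B) :
    restrictDisc ε' (monomial n u : ConvSeries B ε) = monomial n u := rfl

lemma norm_restrictDisc_le (f : ConvSeries B ε) : ‖restrictDisc ε' f‖ ≤ ‖f‖ :=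
  norm_le_of_forall fun n => by
    rw [coeff_restrictDisc]
    exact le_trans (mul_le_mul_of_nonneg_left
      (pow_le_pow_left₀ hε'.out.le h.out.le n) (norm_nonneg _)) (le_norm f n)

section Scalars

variable {k : Type*} [NormedField k] [IsUltrametricDist k] [hε : Fact (0 < ε)]

lemma algebraMap_hbar_pow (n : ℕ) :
    algebraMap (ConvSeries k ε) (ConvSeries k ε') (hbar k ε ^ n) = hbar k ε' ^ n := by
  rw [map_pow]
  rfl

lemma algebraMap_algebraMap (a : k) :
    algebraMap (ConvSeries k ε) (ConvSeries k ε') (algebraMap k (ConvSeries k ε) a) =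
      algebraMap k (ConvSeries k ε') a := rfl

variable {I Φ : Type*} [AddCommGroup Φ] [Module.Free ℤ Φ] {R : RootDatum I Φ} {ρ : Radii}

lemma algebraMap_eq_restrict (c : ConvSeries k ε) :
    algebraMap (ConvSeries k ε) (ConvSeries k ε') c = restrict k h.out c := rfl

lemma coeff_algebraMap (n : ℕ) (c : ConvSeries k ε) :
    coeff n (algebraMap (ConvSeries k ε) (ConvSeries k ε') c) = coeff n c := by
  have h1 : restrict k h.out c = mk (toPowerSeries c) (tendsto_of_lt (ε' := ε') c) := rfl
  rw [algebraMap_eq_restrict, h1, coeff, toPowerSeries_mk, coeff]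

lemma restrictDisc_smul (c : ConvSeries k ε) (x : ConvSeries (EnvAn k R ρ) ε) :
    restrictDisc ε' (c • x) =
      algebraMap (ConvSeries k ε) (ConvSeries k ε') c • restrictDisc ε' x :=
  ext_coeff fun n => by
    rw [coeff_restrictDisc, coeff_smul, coeff_smul]
    refine Finset.sum_congr rfl fun p _ => ?_
    rw [coeff_algebraMap, coeff_restrictDisc]

end Scalars

end ConvSeries

/-! ### The completed base change and its identification with `U{ħ/ε'}`. -/

namespace AlgBaseChange

variable {k : Type*} [NormedField k] [IsUltrametricDist k] {ε ε' : ℝ} [Fact (0 < ε)]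
  [Fact (0 < ε')] [Fact (ε' < ε)] {A : Type*} [NormedRing A] [Algebra (ConvSeries k ε) A]

/-- A pure tensor. -/
def tmul (b : ConvSeries k ε') (a : A) : AlgBaseChange k ε ε' A := b ⊗ₜ[ConvSeries k ε] a

lemma induction_on {p : AlgBaseChange k ε ε' A → Prop} (x : AlgBaseChange k ε ε' A) (zero : p 0)
    (tmul : ∀ b a, p (tmul b a)) (add : ∀ x y, p x → p y → p (x + y)) : p x :=
  TensorProduct.induction_on (motive := p) x zero tmul add

lemma tmul_add (b : ConvSeries k ε') (a a' : A) :
    (tmul b (a + a') : AlgBaseChange k ε ε' A) = tmul b a + tmul b a' :=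
  TensorProduct.tmul_add b a a'

lemma tmul_mul_tmul (b b' : ConvSeries k ε') (a a' : A) :
    (tmul b a * tmul b' a' : AlgBaseChange k ε ε' A) = tmul (b * b') (a * a') :=
  Algebra.TensorProduct.tmul_mul_tmul b b' a a'

lemma smul_tmul (c b : ConvSeries k ε') (a : A) :
    (c • tmul b a : AlgBaseChange k ε ε' A) = tmul (c * b) a :=
  TensorProduct.smul_tmul' c b a

lemma tmul_smul (c : ConvSeries k ε) (b : ConvSeries k ε') (a : A) :
    (tmul b (c • a) : AlgBaseChange k ε ε' A) =
      tmul (algebraMap (ConvSeries k ε) (ConvSeries k ε') c * b) a := by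
  rw [← Algebra.smul_def]
  exact (TensorProduct.smul_tmul c b a).symm

lemma norm_eq_gauge (x : AlgBaseChange k ε ε' A) : ‖x‖ = gauge (tensorGen k ε ε' A) x := rfl

end AlgBaseChange

namespace BaseChange

variable {k : Type*} [NormedField k] [IsUltrametricDist k] {ε ε' : ℝ} [Fact (0 < ε)]
  [Fact (0 < ε')] [Fact (ε' < ε)] {A : Type*} [NormedRing A] [Algebra (ConvSeries k ε) A]

open AlgBaseChange

variable (k ε ε' A) in
/-- The canonical map from the algebraic to the completed base change. -/
def ofAlg : AlgBaseChange k ε ε' A →+* BaseChange k ε ε' A :=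
  UniformSpace.Completion.coeRingHom

lemma denseRange_ofAlg : DenseRange (ofAlg k ε ε' A) :=
  UniformSpace.Completion.denseRange_coe

lemma norm_ofAlg (x : AlgBaseChange k ε ε' A) : ‖ofAlg k ε ε' A x‖ = ‖x‖ :=
  UniformSpace.Completion.norm_coe x

lemma ofAlg_smul (c : ConvSeries k ε') (x : AlgBaseChange k ε ε' A) :
    ofAlg k ε ε' A (c • x) = c • ofAlg k ε ε' A x :=
  UniformSpace.Completion.coe_smul c x

lemma ofAlg_one_tmul (a : A) : ofAlg k ε ε' A (tmul 1 a) = of k ε ε' A a := rfl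

lemma ofAlg_tmul (b : ConvSeries k ε') (a : A) :
    ofAlg k ε ε' A (tmul b a) = b • of k ε ε' A a := by
  rw [← ofAlg_one_tmul, ← ofAlg_smul, smul_tmul, mul_one]

lemma of_add (a b : A) : of k ε ε' A (a + b) = of k ε ε' A a + of k ε ε' A b := by
  simp only [← ofAlg_one_tmul, tmul_add, map_add]

lemma of_mul (a b : A) : of k ε ε' A (a * b) = of k ε ε' A a * of k ε ε' A b := by
  rw [← ofAlg_one_tmul, ← ofAlg_one_tmul, ← ofAlg_one_tmul, ← map_mul, tmul_mul_tmul, mul_one]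

lemma of_one : of k ε ε' A 1 = 1 := map_one (ofAlg k ε ε' A)

lemma of_smul (c : ConvSeries k ε) (a : A) : of k ε ε' A (c • a) =
    algebraMap (ConvSeries k ε) (ConvSeries k ε') c • of k ε ε' A a := by
  rw [← ofAlg_tmul, ← ofAlg_one_tmul, tmul_smul, mul_one]

lemma norm_of_le (a : A) : ‖of k ε ε' A a‖ ≤ ‖a‖ := by
  rw [← ofAlg_one_tmul, norm_ofAlg, norm_eq_gauge]
  refine gauge_le (norm_nonneg a) (AddSubgroup.subset_closure ⟨1, a, ?_, rfl⟩)
  have h := norm_hbar_pow (k := k) (ε := ε') 0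
  rw [pow_zero, pow_zero] at h
  rw [h, one_mul]

instance : IsUltrametricDist (BaseChange k ε ε' A) :=
  IsUltrametricDist.isUltrametricDist_of_forall_norm_add_le_max_norm fun x y => by
    refine denseRange_ofAlg.induction_on₂
      (p := fun x y : BaseChange k ε ε' A => ‖x + y‖ ≤ max ‖x‖ ‖y‖)
      (isClosed_le (by fun_prop) (by fun_prop)) (fun x y => ?_) x y
    rw [← map_add, norm_ofAlg, norm_ofAlg, norm_ofAlg, norm_eq_gauge, norm_eq_gauge,
      norm_eq_gauge]
    exact gauge_add_le_max tensorGen_mono tensorGen_total x y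

instance : IsBoundedSMul (ConvSeries k ε') (BaseChange k ε ε' A) :=
  IsBoundedSMul.of_norm_smul_le fun c x => by
    have hc : Continuous fun x : BaseChange k ε ε' A => c • x := by
      simp only [Algebra.smul_def]
      exact continuous_const_mul _
    refine denseRange_ofAlg.induction_on (p := fun x : BaseChange k ε ε' A =>
      ‖c • x‖ ≤ ‖c‖ * ‖x‖) x (isClosed_le hc.norm (continuous_norm.const_mul _)) fun y => ?_
    rw [← ofAlg_smul, norm_ofAlg, norm_ofAlg]
    exact norm_smul_le c y

/-- A bounded linear map on the completed base change is given by its values on `A`. -/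
lemma exists_lift {W : Type*} [NormedAddCommGroup W] [IsUltrametricDist W] [CompleteSpace W]
    [Module (ConvSeries k ε') W] [IsBoundedSMul (ConvSeries k ε') W] (f : A →+ W) {C : ℝ}
    (hC : 0 ≤ C) (hf : ∀ a, ‖f a‖ ≤ C * ‖a‖)
    (hsmul : ∀ (c : ConvSeries k ε) a,
      f (c • a) = algebraMap (ConvSeries k ε) (ConvSeries k ε') c • f a) :
    ∃ F : BaseChange k ε ε' A →ₗ[ConvSeries k ε'] W,
      (∀ a, F (of k ε ε' A a) = f a) ∧ ∀ x, ‖F x‖ ≤ C * ‖x‖ := by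
  let F₀ : AlgBaseChange k ε ε' A →+ W := TensorProduct.liftAddHom
    (AddMonoidHom.mk' (fun b : ConvSeries k ε' => (DistribSMul.toAddMonoidHom W b).comp f)
      fun b b' => AddMonoidHom.ext fun a => add_smul b b' (f a))
    (fun c b a => by
      change (c • b) • f a = b • f (c • a)
      rw [hsmul, Algebra.smul_def, mul_comm, mul_smul])
  have hF₀ : ∀ (b : ConvSeries k ε') (a : A), F₀ (tmul b a) = b • f a :=
    fun b a => rfl
  have hbound : ∀ x, ‖F₀ x‖ ≤ C * ‖x‖ := by
    intro x
    rw [norm_eq_gauge]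
    -- The tensor seminorm is the gauge of pure tensors, so a bound on pure tensors together with
    -- the ultrametric inequality in `W` bounds the map; letting the weight tend to the infimum
    -- gives the constant `C`.
    have key : ∀ c, 0 ≤ c → x ∈ AddSubgroup.closure (tensorGen k ε ε' A c) → ‖F₀ x‖ ≤ C * c := by
      intro c hc hx
      refine AddSubgroup.closure_induction (p := fun x _ => ‖F₀ x‖ ≤ C * c) ?_ ?_ ?_ ?_ hx
      · rintro _ ⟨b, a, hba, rfl⟩
        refine (congrArg norm (hF₀ b a)).le.trans ?_
        calc ‖b • f a‖ ≤ ‖b‖ * ‖f a‖ := norm_smul_le _ _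
          _ ≤ ‖b‖ * (C * ‖a‖) := by gcongr; exact hf a
          _ = C * (‖b‖ * ‖a‖) := by ring
          _ ≤ C * c := by gcongr
      · rw [map_zero, norm_zero]; positivity
      · intro y z _ _ hy hz
        rw [map_add]
        exact (IsUltrametricDist.norm_add_le_max _ _).trans (max_le hy hz)
      · intro y _ hy
        rwa [map_neg, norm_neg]
    have h1 : Tendsto (fun t : ℝ => C * (gauge (tensorGen k ε ε' A) x + t)) (𝓝[>] 0)
        (𝓝 (C * gauge (tensorGen k ε ε' A) x)) := by
      have : Continuous fun t : ℝ => C * (gauge (tensorGen k ε ε' A) x + t) := by fun_prop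
      simpa using (this.tendsto 0).mono_left nhdsWithin_le_nhds
    refine ge_of_tendsto h1 ?_
    filter_upwards [self_mem_nhdsWithin] with t ht
    obtain ⟨c, hc0, hct, hx⟩ := gauge_lt (G := tensorGen k ε ε' A) tensorGen_total
      (lt_add_of_pos_right (gauge (tensorGen k ε ε' A) x) ht)
    exact (key c hc0 hx).trans (mul_le_mul_of_nonneg_left hct.le hC)
  let F₁ : NormedAddGroupHom (AlgBaseChange k ε ε' A) W :=
    { toFun := F₀
      map_add' := F₀.map_add
      bound' := ⟨C, hbound⟩ }
  let F : BaseChange k ε ε' A →+ W := F₁.extension.toAddMonoidHom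
  have hFc : Continuous F := F₁.extension.continuous
  have hFF : ∀ x, F (ofAlg k ε ε' A x) = F₀ x := fun x => F₁.extension_coe x
  have hsm : ∀ (c : ConvSeries k ε') x, F₀ (c • x) = c • F₀ x := by
    intro c x
    induction x using induction_on with
    | zero => rw [smul_zero, map_zero, smul_zero]
    | tmul b a => rw [smul_tmul, hF₀, hF₀, mul_smul]
    | add x y hx hy => rw [smul_add, map_add, hx, hy, map_add, smul_add]
  refine ⟨{ F with map_smul' := fun c x => ?_ }, fun a => ?_, fun x => ?_⟩
  · refine denseRange_ofAlg.induction_on (p := fun x : BaseChange k ε ε' A =>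
      F (c • x) = c • F x) x (isClosed_eq (hFc.comp (continuous_const_smul c))
      ((continuous_const_smul c).comp hFc)) fun y => ?_
    rw [← ofAlg_smul, hFF, hFF, hsm]
  · change F (of k ε ε' A a) = f a
    rw [← ofAlg_one_tmul, hFF, hF₀, one_smul]
  · change ‖F x‖ ≤ C * ‖x‖
    refine denseRange_ofAlg.induction_on (p := fun x : BaseChange k ε ε' A =>
      ‖F x‖ ≤ C * ‖x‖) x (isClosed_le hFc.norm (continuous_norm.const_mul _)) fun y => ?_
    rw [hFF, norm_ofAlg]
    exact hbound y

lemma addMonoidHom_ext {W : Type*} [AddCommGroup W] [TopologicalSpace W] [T2Space W]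
    {f g : BaseChange k ε ε' A →+ W} (hf : Continuous f) (hg : Continuous g)
    (h : ∀ (b : ConvSeries k ε') a, f (b • of k ε ε' A a) = g (b • of k ε ε' A a)) (x) :
    f x = g x := by
  refine denseRange_ofAlg.induction_on (p := fun x => f x = g x) x (isClosed_eq hf hg) fun y => ?_
  induction y using induction_on with
  | zero => rw [map_zero, map_zero, map_zero]
  | tmul b a => rw [ofAlg_tmul, h]
  | add x y hx hy => rw [map_add, map_add, hx, hy, map_add]

variable {I Φ : Type*} [AddCommGroup Φ] [Module.Free ℤ Φ] {R : RootDatum I Φ} {ρ : Radii}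

/-- The completed base change of a module `A ≅ U{ħ/ε}` is `U{ħ/ε'}`. -/
lemma exists_linearEquiv (φ : A ≃ₗ[ConvSeries k ε] ConvSeries (EnvAn k R ρ) ε)
    (hφ : IsBoundedMap φ) (hφ_symm : IsBoundedMap φ.symm) :
    ∃ ψ : BaseChange k ε ε' A ≃ₗ[ConvSeries k ε'] ConvSeries (EnvAn k R ρ) ε',
      IsBoundedMap ψ ∧ IsBoundedMap ψ.symm ∧
      (∀ a, ψ (of k ε ε' A a) = restrictDisc ε' (φ a)) ∧
      ∀ u, ψ.symm (monomial 0 u) = of k ε ε' A (φ.symm (monomial 0 u)) := by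
  obtain ⟨C₁, hC₁⟩ := hφ
  obtain ⟨C₂, hC₂⟩ := hφ_symm
  have hφc : Continuous φ.symm :=
    AddMonoidHomClass.continuous_of_bound φ.symm.toAddMonoidHom C₂ hC₂
  have hbd₁ : ∀ a, ‖restrictDisc ε' (φ a)‖ ≤ max C₁ 0 * ‖a‖ := fun a =>
    (norm_restrictDisc_le _).trans ((hC₁ a).trans
      (mul_le_mul_of_nonneg_right (le_max_left _ _) (norm_nonneg a)))
  -- `F` is determined by restricting `φ a` to the smaller disc. Its inverse `G` below is the
  -- `ħ`-linear extension of `u ↦ 1 ⊗ φ⁻¹(u)`. One composite is checked on monomials, the other on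
  -- pure tensors.
  obtain ⟨F, hF, hFb⟩ := exists_lift (ε' := ε')
    ((restrictDisc ε').comp φ.toAddMonoidHom) (le_max_right C₁ 0) hbd₁
    (fun c a => (congrArg (restrictDisc ε') (map_smul φ c a)).trans (restrictDisc_smul c _))
  replace hF : ∀ a, F (of k ε ε' A a) = restrictDisc ε' (φ a) := hF
  let ofHom : A →+ BaseChange k ε ε' A := AddMonoidHom.mk' (of k ε ε' A) of_add
  have hofc : Continuous ofHom := AddMonoidHomClass.continuous_of_bound ofHom 1 fun a => by
    rw [one_mul]; exact norm_of_le a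
  obtain ⟨G, hG, hGb⟩ := exists_extension (ε := ε')
    ((ofHom.comp φ.symm.toAddMonoidHom).comp (monomial (B := EnvAn k R ρ) (ε := ε) 0))
    (le_max_right C₂ 0) (fun u => by
      refine (norm_of_le _).trans ((hC₂ _).trans ?_)
      rw [norm_monomial, pow_zero, mul_one]
      exact mul_le_mul_of_nonneg_right (le_max_left _ _) (norm_nonneg u))
    (fun a u => by
      change of k ε ε' A (φ.symm (monomial 0 (a • u))) = _ • of k ε ε' A (φ.symm (monomial 0 u))
      have : (monomial 0 (a • u) : ConvSeries (EnvAn k R ρ) ε) =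
          algebraMap k (ConvSeries k ε) a • monomial 0 u := by
        rw [algebraMap_eq_monomial, monomial_smul_monomial]
      rw [this, map_smul, of_smul, algebraMap_algebraMap])
  replace hG : ∀ u, G (monomial 0 u) = of k ε ε' A (φ.symm (monomial 0 u)) := hG
  have hFc : Continuous F := AddMonoidHomClass.continuous_of_bound F.toAddMonoidHom _ hFb
  have hGc : Continuous G := AddMonoidHomClass.continuous_of_bound G.toAddMonoidHom _ hGb
  have hrc : Continuous (restrictDisc (B := EnvAn k R ρ) (ε := ε) ε') :=
    AddMonoidHomClass.continuous_of_bound _ 1 fun x => by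
      rw [one_mul]; exact norm_restrictDisc_le x
  have hFG : ∀ x, F (G x) = x :=
    map_eq_of_monomial (f := F.toAddMonoidHom.comp G.toAddMonoidHom) (g := AddMonoidHom.id _)
      (hFc.comp hGc) continuous_id fun n u => by
        change F (G (monomial n u)) = monomial n u
        rw [monomial_eq_smul (k := k), map_smul, map_smul, hG, hF, LinearEquiv.apply_symm_apply,
          restrictDisc_monomial]
  have hGr : ∀ x, G (restrictDisc ε' x) = of k ε ε' A (φ.symm x) :=
    map_eq_of_monomial (f := G.toAddMonoidHom.comp (restrictDisc ε'))
      (g := ofHom.comp φ.symm.toAddMonoidHom) (hGc.comp hrc) (hofc.comp hφc) fun n u => by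
        change G (restrictDisc ε' (monomial n u)) = of k ε ε' A (φ.symm (monomial n u))
        rw [restrictDisc_monomial, monomial_eq_smul (k := k) (ε := ε), map_smul, of_smul,
          algebraMap_hbar_pow, ← hG, ← map_smul, ← monomial_eq_smul]
  have hGF : ∀ x, G (F x) = x :=
    addMonoidHom_ext (f := G.toAddMonoidHom.comp F.toAddMonoidHom) (g := AddMonoidHom.id _)
      (hGc.comp hFc) continuous_id fun b a => by
        change G (F (b • of k ε ε' A a)) = b • of k ε ε' A a
        rw [map_smul, map_smul, hF, hGr, LinearEquiv.symm_apply_apply]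
  exact ⟨LinearEquiv.ofLinearMap F G (LinearMap.ext hFG) (LinearMap.ext hGF), ⟨_, hFb⟩, ⟨_, hGb⟩,
    hF, hG⟩

end BaseChange

end

end Rigidity

/-! ### The rigidity theorem. -/

theorem theorem3p53
    {k : Type*} [NormedField k] [IsUltrametricDist k] [CompleteSpace k]
    {I Φ : Type*} [AddCommGroup Φ] [Module.Free ℤ Φ]
    (R : Rigidity.RootDatum I Φ) (ρ : Rigidity.Radii)
    (hexact : Rigidity.StrictlyExactAtTwo k (Rigidity.lieAn k R ρ) (Rigidity.EnvAn k R ρ))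
    (hinv : Rigidity.ContractingInverseAtTwo k (Rigidity.lieAn k R ρ) (Rigidity.EnvAn k R ρ))
    (ε : ℝ) [Fact (0 < ε)]
    {A : Type*} [NormedRing A] [IsUltrametricDist A] [CompleteSpace A] [NormedAlgebra k A]
    [Algebra (Rigidity.ConvSeries k ε) A] [IsScalarTower k (Rigidity.ConvSeries k ε) A]
    (φ : A ≃ₗ[Rigidity.ConvSeries k ε] Rigidity.ConvSeries (Rigidity.EnvAn k R ρ) ε)
    (hφ : Rigidity.IsBoundedMap φ) (hφ_symm : Rigidity.IsBoundedMap φ.symm)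
    (hφ_one : φ 1 = 1)
    (hφ_mul : ∀ x y, ‖φ (φ.symm x * φ.symm y)‖ ≤ ‖x‖ * ‖y‖)
    (θ : (A ⧸ Rigidity.hbarIdeal k ε A) ≃ₐ[k] Rigidity.EnvAn k R ρ)
    (hθ : ∀ a : A, θ (Ideal.Quotient.mk (Rigidity.hbarIdeal k ε A) a) =
      Rigidity.ConvSeries.constCoeff (φ a))
    (ε' : ℝ) [Fact (0 < ε')] [Fact (ε' < ε)] :
    ∃ α : Rigidity.BaseChange k ε ε' A ≃ₐ[Rigidity.ConvSeries k ε']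
        Rigidity.ConvSeries (Rigidity.EnvAn k R ρ) ε',
      Rigidity.IsBoundedMap α ∧ Rigidity.IsBoundedMap α.symm ∧
      ∀ a : A, Rigidity.ConvSeries.constCoeff (α (Rigidity.BaseChange.of k ε ε' A a)) =
        θ (Ideal.Quotient.mk (Rigidity.hbarIdeal k ε A) a) := by
  obtain ⟨ψ, ⟨C₁, hC₁⟩, ⟨C₂, hC₂⟩, hψ, hψ_symm⟩ :=
    Rigidity.BaseChange.exists_linearEquiv (ε' := ε') φ hφ hφ_symm
  have hmul : ∀ u v, ψ (ψ.symm (Rigidity.ConvSeries.monomial 0 u) *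
      ψ.symm (Rigidity.ConvSeries.monomial 0 v)) = Rigidity.ConvSeries.restrictDisc ε'
        (φ (φ.symm (Rigidity.ConvSeries.monomial 0 u) *
          φ.symm (Rigidity.ConvSeries.monomial 0 v))) := fun u v => by
    rw [hψ_symm, hψ_symm, ← Rigidity.BaseChange.of_mul, hψ]
  -- The inner radius is `ε'` and the outer one `ε`: contractivity of the transported product on the
  -- original disc is exactly the coefficient bound at radius `ε`. That `θ` is multiplicative
  -- identifies the product modulo `ħ` with that of `U`.
  let D : Rigidity.Deformation k R ρ ε' ε (Rigidity.BaseChange k ε ε' A) :=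
    { equiv := ψ
      equiv_one := by
        rw [← Rigidity.BaseChange.of_one, hψ, hφ_one, Rigidity.ConvSeries.restrictDisc_one]
      lt := Fact.out
      coeff_zero_mul_const := fun u v => by
        rw [hmul, Rigidity.ConvSeries.coeff_restrictDisc, ← Rigidity.ConvSeries.constCoeff_eq,
          ← hθ, map_mul, map_mul, hθ, hθ, LinearEquiv.apply_symm_apply,
          LinearEquiv.apply_symm_apply, Rigidity.ConvSeries.constCoeff_eq,
          Rigidity.ConvSeries.constCoeff_eq, Rigidity.ConvSeries.coeff_monomial_same,
          Rigidity.ConvSeries.coeff_monomial_same]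
      norm_coeff_mul_const_le := fun n u v => by
        rw [hmul, Rigidity.ConvSeries.coeff_restrictDisc]
        refine (Rigidity.ConvSeries.le_norm _ n).trans ((hφ_mul _ _).trans (le_of_eq ?_))
        rw [Rigidity.ConvSeries.norm_monomial, Rigidity.ConvSeries.norm_monomial, pow_zero,
          mul_one, mul_one]
      bounded_mul := by
        refine ⟨|C₁| * (|C₂| * |C₂|), fun x y => ?_⟩
        have h1 : ∀ z, ‖z‖ ≤ |C₂| * ‖ψ z‖ := fun z => by
          have := hC₂ (ψ z)
          rw [LinearEquiv.symm_apply_apply] at this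
          exact this.trans (mul_le_mul_of_nonneg_right (le_abs_self _) (norm_nonneg _))
        calc ‖ψ (x * y)‖ ≤ C₁ * ‖x * y‖ := hC₁ _
          _ ≤ |C₁| * (‖x‖ * ‖y‖) := mul_le_mul (le_abs_self _) (norm_mul_le x y)
            (norm_nonneg _) (abs_nonneg _)
          _ ≤ |C₁| * ((|C₂| * ‖ψ x‖) * (|C₂| * ‖ψ y‖)) := by
            gcongr
            exacts [h1 x, h1 y]
          _ = |C₁| * (|C₂| * |C₂|) * ‖ψ x‖ * ‖ψ y‖ := by ring }
  -- The base change is viewed over `k` through the constants of `k{ħ/ε'}`, which makes the scalar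
  -- tower hold by definition.
  let _ : Algebra k (Rigidity.BaseChange k ε ε' A) :=
    Algebra.compHom _ (algebraMap k (Rigidity.ConvSeries k ε'))
  have _ : IsScalarTower k (Rigidity.ConvSeries k ε') (Rigidity.BaseChange k ε ε' A) :=
    IsScalarTower.of_algebraMap_eq fun _ => rfl
  obtain ⟨α, hα⟩ := D.exists_algEquiv hexact hinv
  -- Since `‖α x‖ = ‖ψ x‖`, the bounds for `ψ` and its inverse hold for `α` with the same constants.
  refine ⟨α, ⟨C₁, fun x => ?_⟩, ⟨C₂, fun y => ?_⟩, fun a => ?_⟩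
  · rw [(hα x).1]
    exact hC₁ x
  · have h1 := (hα (α.symm y)).1
    rw [AlgEquiv.apply_symm_apply] at h1
    rw [h1]
    have := hC₂ (ψ (α.symm y))
    rwa [LinearEquiv.symm_apply_apply] at this
  · rw [(hα _).2, hθ]
    change Rigidity.ConvSeries.constCoeff (ψ _) = _
    rw [hψ, Rigidity.ConvSeries.constCoeff_eq, Rigidity.ConvSeries.coeff_restrictDisc,
      Rigidity.ConvSeries.constCoeff_eq]
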